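/- **Global minimum approximation of discretization.** Let $N\ge 0$ and $D\ge 1$ be integers. For a matrix $T\in\mathbb R^{D\times(N+1)}$ let $\|T\|_F$ be its Frobenius norm, $\|T\|_{\mathrm{col}}$ the maximum Euclidean norm of its columns, and $\mathrm{Read}[T]$ the entry of $T$ in a fixed row $a\in\{1,\dots,D\}$ and the last column. *Data.* Let $\mu$ be a probability measure on $\mathbb R^{D\times(N+1)}$ and $y:\mathbb R^{D\times(N+1)}\to\mathbb R$ a function such that, for constants $B,K_y>0$, $\|H\|_{\mathrm{col}}\le B$ and $|y(H)|\le B$ for all $H\in\mathrm{supp}(\mu)$, and $y$ is $K_y$-Lipschitz for $\|\cdot\|_F$ on $\mathrm{supp}(\mu)$. *Encoders.* Let $f:\mathbb R^{D\times(N+1)}\times\mathbb R^p\to\mathbb R^{D\times(N+1)}$ and $h:\mathbb R^{D\times(N+1)}\times\mathbb R^q\to\mathbb R^{D\times(N+1)}$ be such that the gradients of $f$ with respect to $\theta$ and with respect to $T$ exist everywhere and, for all $T$, $\theta$ and every column index $i$, $$\|f(T,\theta)\|_{\mathrm{col}}\le K\|T\|_{\mathrm{col}}(1+\|\theta\|+\|\theta\|^2),\qquad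 \|\nabla_\theta f(T,\theta)_{:,i}\|_2\le\phi_P(\|T\|_{\mathrm{col}})(1+\|\theta\|),$$ $$\|\nabla_{\mathrm{vec}\,T}\,\mathrm{vec} f(T,\theta)\|_2\le\phi_T(\|T\|_F)(1+\|\theta\|+\|\theta\|^2),$$ where $K>0$ and $\phi_P,\phi_T$ are continuous nondecreasing functions on $[0,\infty)$ (which may depend on $N$ and $D$), and the same holds for $h$ and $w$ in place of $f$ and $\theta$. *Discrete Transformer.* For depth $L\ge1$ and width $M\ge 1$ let $\Delta t=1/L$. For parameters $\Theta=(\theta_{t,j},w_{t,j})$, with $t=0,\Delta t,\dots,(L-1)\Delta t$ and $j=1,\dots,M$, let $\widehat T_\Theta(H,0)=H$ and $$\widehat T_\Theta(H,t+\tfrac{\Delta t}{2})=\widehat T_\Theta(H,t)+\tfrac{\Delta t}{2M}\sum_{j=1}^M f(\widehat T_\Theta(H,t),\theta_{t,j}),$$ $$\widehat T_\Theta(H,t+\Delta t)=\widehat T_\Theta(H,t+\tfrac{\Delta t}2)+\tfrac{\Delta t}{2M}\sum_{j=1}^M h(\widehat T_\Theta(H,t+\tfrac{\Delta t}2),w_{t,j}).$$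 Let $\widehat R(\Theta)=\mathbb E_{H\sim\mu}\big[\tfrac12(\mathrm{Read}[\widehat T_\Theta(H,1)]-y(H))^2\big]$ and $\widehat Q(\Theta)=\widehat R(\Theta)+\frac{\lambda}{2ML}\sum_{t}\sum_{j}(\|\theta_{t,j}\|^2+\|w_{t,j}\|^2)$. *Continuous Transformer.* Let $\mathcal P^2$ be the set of probability measures $\rho(d\theta,dw,t)\,dt$ on $\mathbb R^p\times\mathbb R^q\times[0,1]$ with finite second moment whose slices $\rho(\cdot,t)$ are finite measures (not necessarily of mass one) satisfying $\|\rho(\cdot,t)-\rho(\cdot,t')\|_{\mathrm{BL}}\le C_\rho|t-t'|$ for all $t,t'\in[0,1]$ and some $C_\rho>0$; here $\|\nu\|_{\mathrm{BL}}$ is the supremum of $\int\varphi\,d\nu$ over all $1$-Lipschitz $\varphi$ with $\sup|\varphi|\le1$. For $r>0$ let $\mathcal P^{2,r}$ be the set of $\rho\in\mathcal P^2$ concentrated on $\{(\theta,w):\|\theta\|^2+\|w\|^2\le r^2\}\times[0,1]$. For $\rho\in\mathcal P^{2,r}$ let $T_\rho(H,\cdot)$ be the solution on $[0,1]$ of $$\dot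 T_\rho(H,t)=\int\frac{f(T_\rho(H,t),\theta)+h(T_\rho(H,t),w)}{2}\,\rho(d\theta,dw,t),\qquad T_\rho(H,0)=H,$$ and let $R(\rho)=\mathbb E_{H\sim\mu}\big[\tfrac12(\mathrm{Read}[T_\rho(H,1)]-y(H))^2\big]$ and $Q(\rho)=R(\rho)+\frac\lambda2\int_0^1\int(\|\theta\|^2+\|w\|^2)\,\rho(d\theta,dw,t)\,dt$. *Claim.* For every $r>0$ there is a constant $C>0$, depending only on $N,D,r,B,K_y,K,\phi_P,\phi_T$, such that for all $p$, $q$, $f$, $h$, $\mu$, $y$, $a$ as above, all $L,M\ge1$ and all $\lambda>0$, $$\inf_\Theta\widehat R(\Theta)\le\inf_{\rho\in\mathcal P^{2,r}}R(\rho)+C\Big(L^{-1}+\sqrt{\tfrac{\log(L+1)}{M}}\Big),$$ $$\inf_\Theta\widehat Q(\Theta)\le\inf_{\rho\in\mathcal P^{2,r}}Q(\rho)+C(1+\lambda)\Big(L^{-1}+\sqrt{\tfrac{\log(L+1)}{M}}\Big).$$ -/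

import Mathlib

open MeasureTheory ProbabilityTheory Set

noncomputable section

namespace MeanFieldTransformer

/-- Parameter vectors with `p` coordinates, with the Euclidean norm. -/
abbrev Vec (p : ℕ) : Type := EuclideanSpace ℝ (Fin p)

/-- Real `D × (N + 1)` matrices (sequences of `N + 1` tokens in `ℝ^D`), identified with their
vectorization: the norm is the Frobenius norm, and the operator norm of a linear map between such
spaces is the spectral norm of the corresponding matrix acting on vectorized sequences. -/
abbrev Seq (D N : ℕ) : Type := EuclideanSpace ℝ (Fin D × Fin (N + 1))

/-- A particle `β = (θ, w)`, with the norm `‖β‖² = ‖θ‖² + ‖w‖²`. -/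
abbrev Particle (p q : ℕ) : Type := WithLp 2 (Vec p × Vec q)

variable {N D p q : ℕ}

/-- The `i`-th column (token) of a matrix. -/
def col (T : Seq D N) (i : Fin (N + 1)) : Vec D := WithLp.toLp 2 fun a => T (a, i)

/-- The maximum Euclidean norm over all columns of a matrix. -/
def colNorm (T : Seq D N) : ℝ := ⨆ i, ‖col T i‖

/-- The read-out: the entry in row `a` of the last column. -/
def read (a : Fin D) (T : Seq D N) : ℝ := T (a, Fin.last N)

/-! ### Assumptions -/

/-- Data regularity with constants `B` and `Ky`. -/
structure DataRegularity (B Ky : ℝ) (μ : Measure (Seq D N)) (y : Seq D N → ℝ) : Prop where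
  colNorm_le : ∀ H ∈ μ.support, colNorm H ≤ B
  abs_label_le : ∀ H ∈ μ.support, |y H| ≤ B
  label_lipschitz : ∀ H ∈ μ.support, ∀ H' ∈ μ.support, |y H - y H'| ≤ Ky * ‖H - H'‖

/-- A continuous, monotonically increasing function on `[0, ∞)`. -/
def IsGrowthFunction (φ : ℝ → ℝ) : Prop := ContinuousOn φ (Ici 0) ∧ MonotoneOn φ (Ici 0)

/-- The particle growth bound for an encoder `f`, with constant `K` and growth functions `φP`, `φT`
(the dimensions `N` and `D` being fixed). The gradients in `θ` and in `T` exist everywhere. -/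
structure ParticleGrowth (K : ℝ) (φP φT : ℝ → ℝ) (f : Seq D N → Vec p → Seq D N) : Prop where
  differentiable_param : ∀ T, Differentiable ℝ fun θ => f T θ
  differentiable_input : ∀ θ, Differentiable ℝ fun T => f T θ
  colNorm_le : ∀ T θ, colNorm (f T θ) ≤ K * colNorm T * (1 + ‖θ‖ + ‖θ‖ ^ 2)
  grad_param_le : ∀ T θ i,
    ‖fderiv ℝ (fun θ' => col (f T θ') i) θ‖ ≤ φP (colNorm T) * (1 + ‖θ‖)
  grad_input_le : ∀ T θ,
    ‖fderiv ℝ (fun T' => f T' θ) T‖ ≤ φT ‖T‖ * (1 + ‖θ‖ + ‖θ‖ ^ 2)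

/-! ### The discrete Transformer -/

/-- A residual layer averaging `M` heads: `Z + η M⁻¹ ∑ⱼ e(Z, αⱼ)`. It is the attention layer when `e`
is the attention encoder, and the feed-forward layer when `e` is the feed-forward encoder. -/
def residualLayer {M : ℕ} (e : Seq D N → Vec p → Seq D N) (α : Fin M → Vec p) (Z : Seq D N)
    (η : ℝ) : Seq D N :=
  Z + η • ((M : ℝ)⁻¹ • ∑ j, e Z (α j))

/-- All the parameters `(θ_{t,j}, w_{t,j})` of a Transformer of depth `L` and width `M`; the depth
index `t = k / L` is represented by `k`. -/
abbrev Params (p q L M : ℕ) : Type := Fin L → Fin M → Particle p q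

/-- A Transformer block: an attention layer followed by a feed-forward layer, both with step `η`. -/
def block {M : ℕ} (f : Seq D N → Vec p → Seq D N) (h : Seq D N → Vec q → Seq D N)
    (β : Fin M → Particle p q) (η : ℝ) (Z : Seq D N) : Seq D N :=
  residualLayer h (fun j => (β j).snd) (residualLayer f (fun j => (β j).fst) Z η) η

/-- The hidden state of the discrete Transformer at depth `k / L`, for `k = 0, …, L`, with step
size `1 / (2 L)`. -/
def discreteState {L M : ℕ} (f : Seq D N → Vec p → Seq D N) (h : Seq D N → Vec q → Seq D N)
    (Θ : Params p q L M) (H : Seq D N) (k : Fin (L + 1)) : Seq D N :=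
  Fin.induction (motive := fun _ => Seq D N) H
    (fun k Z => block f h (Θ k) (1 / (L : ℝ) / 2) Z) k

/-- The population squared risk of the discrete Transformer. -/
def discreteRisk {L M : ℕ} (f : Seq D N → Vec p → Seq D N) (h : Seq D N → Vec q → Seq D N)
    (μ : Measure (Seq D N)) (y : Seq D N → ℝ) (a : Fin D) (Θ : Params p q L M) : ℝ :=
  ∫ H, 1 / 2 * (read a (discreteState f h Θ H (Fin.last L)) - y H) ^ 2 ∂μ

/-- The regularized objective of the discrete Transformer. -/
def discreteObjective {L M : ℕ} (f : Seq D N → Vec p → Seq D N) (h : Seq D N → Vec q → Seq D N)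
    (μ : Measure (Seq D N)) (y : Seq D N → ℝ) (a : Fin D) (lam : ℝ) (Θ : Params p q L M) : ℝ :=
  discreteRisk f h μ y a Θ
    + lam / (2 * M * L) * ∑ k, ∑ j, (‖(Θ k j).fst‖ ^ 2 + ‖(Θ k j).snd‖ ^ 2)

/-! ### The continuous Transformer -/

/-- The bounded Lipschitz norm of the difference of two finite measures. -/
def blDist (ν ν' : Measure (Particle p q)) : ℝ :=
  sSup {x | ∃ φ : Particle p q → ℝ, (∀ β, |φ β| ≤ 1) ∧ LipschitzWith 1 φ ∧
    x = ∫ β, φ β ∂ν - ∫ β, φ β ∂ν'}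

/-- The class `𝒫²`. A distribution `ρ(β, t)` on particles and depths `t ∈ [0, 1]` is given by its
slices `ρ(·, t)`, so it is the measure `ρ(dβ, t) dt`. It is a probability measure with finite second
moment, and its slices are finite measures that are Lipschitz in `t` in the bounded Lipschitz norm.
The single slices need not have mass one. -/
structure MemP2 (ρ : Kernel unitInterval (Particle p q)) : Prop where
  finite_slice : ∀ t, IsFiniteMeasure (ρ t)
  total_mass : ∫⁻ t, ρ t univ = 1
  second_moment : ∫⁻ t, ∫⁻ β, ‖β‖ₑ ^ 2 ∂(ρ t) < ⊤
  lipschitz_slice : ∃ Cρ : ℝ, 0 < Cρ ∧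
    ∀ t t' : unitInterval, blDist (ρ t) (ρ t') ≤ Cρ * |(t : ℝ) - t'|

/-- The class `𝒫^{2,r}` of the distributions in `𝒫²` that are concentrated on
`{(θ, w) : ‖θ‖² + ‖w‖² ≤ r²} × [0, 1]`. -/
def P2 (p q : ℕ) (r : ℝ) : Set (Kernel unitInterval (Particle p q)) :=
  {ρ | MemP2 ρ ∧ ∀ t, ρ t {β | ‖β.fst‖ ^ 2 + ‖β.snd‖ ^ 2 ≤ r ^ 2}ᶜ = 0}

/-- `T` solves the Transformer ODE on `[0, 1]` with initial value `H`. -/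
def SolvesTransformerODE (f : Seq D N → Vec p → Seq D N) (h : Seq D N → Vec q → Seq D N)
    (ρ : Kernel unitInterval (Particle p q)) (H : Seq D N) (T : ℝ → Seq D N) : Prop :=
  T 0 = H ∧ ∀ t : unitInterval,
    HasDerivWithinAt T (∫ β, (1 / 2 : ℝ) • (f (T t) β.fst + h (T t) β.snd) ∂(ρ t)) (Icc 0 1) t

/-- The continuous Transformer `T_ρ(H, ·)`: the solution of the Transformer ODE. -/
def flow (f : Seq D N → Vec p → Seq D N) (h : Seq D N → Vec q → Seq D N)
    (ρ : Kernel unitInterval (Particle p q)) (H : Seq D N) : ℝ → Seq D N :=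
  Classical.epsilon (SolvesTransformerODE f h ρ H)

/-- The population squared risk of the continuous Transformer. -/
def risk (f : Seq D N → Vec p → Seq D N) (h : Seq D N → Vec q → Seq D N)
    (μ : Measure (Seq D N)) (y : Seq D N → ℝ) (a : Fin D)
    (ρ : Kernel unitInterval (Particle p q)) : ℝ :=
  ∫ H, 1 / 2 * (read a (flow f h ρ H 1) - y H) ^ 2 ∂μ

/-- The regularized objective of the continuous Transformer. -/
def objective (f : Seq D N → Vec p → Seq D N) (h : Seq D N → Vec q → Seq D N)
    (μ : Measure (Seq D N)) (y : Seq D N → ℝ) (a : Fin D) (lam : ℝ)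
    (ρ : Kernel unitInterval (Particle p q)) : ℝ :=
  risk f h μ y a ρ
    + lam / 2 * ∫ t, ∫ β, (‖β.fst‖ ^ 2 + ‖β.snd‖ ^ 2) ∂(ρ t)

end MeanFieldTransformer

end

/-! It suffices to approximate one `ρ` in `P2 p q r` at a time: some `Θ` must have an objective at
most that of `ρ` plus an error that is uniform in `ρ`, after which infima are taken.

Slices need not have mass one, so [0, 1] is cut at the quantiles of the slice mass
(`exists_mass_grid`). On each of the L intervals the mass is 1/L, and L times the accumulated slices
is a probability measure on the ball of radius r. Layer k receives M particles chosen for the k-th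
of these measures. All estimates of the flow involve the slice mass only through its time integral,
which is one, so no bound depends on how the mass is spread over time or on the Lipschitz constant
of the slices.

The particles are selected by a derandomized second-moment argument (`exists_sample`). Summands that
are centered under the sampling law have no cross terms on average, so M samples can be chosen one
by one with mean deviation O(M^(-1/2)) in L¹(μ). The penalty is carried along in the same selection
and costs nothing extra. The deviations are measured along the flow and not along the discrete
trajectory, so the layers are chosen independently of each other. Only the average of the deviations
over layers and data enters, so no union bound is needed.

A discrete Grönwall argument (`norm_discreteState_sub_extendFlow_le`) adds up the stability,
sampling, block and Euler errors. Linear growth in the column norm keeps both evolutions in a fixed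
ball, where the encoders are Lipschitz. On that ball the squared loss is Lipschitz as well
(`discreteRisk_le_risk_add`). The error obtained is O(1/L + M^(-1/2)) without a factor λ, which is
stronger than the claim. -/

noncomputable section
namespace MeanFieldTransformer
variable {N D p q : ℕ}

/-! ### The column norm -/

/-- The `i`-th column as a continuous linear map. -/
def colL (i : Fin (N + 1)) : Seq D N →L[ℝ] Vec D :=
  LinearMap.toContinuousLinearMap
    { toFun := fun T => col T i
      map_add' := fun _ _ => rfl
      map_smul' := fun _ _ => rfl }

lemma colL_apply (i : Fin (N + 1)) (T : Seq D N) : colL i T = col T i := rfl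

lemma norm_col_le_colNorm (T : Seq D N) (i : Fin (N + 1)) : ‖col T i‖ ≤ colNorm T :=
  le_ciSup (f := fun i => ‖col T i‖) (Set.finite_range _).bddAbove i

lemma colNorm_le_of_forall {T : Seq D N} {c : ℝ} (h : ∀ i, ‖col T i‖ ≤ c) : colNorm T ≤ c :=
  ciSup_le h

lemma colNorm_nonneg (T : Seq D N) : 0 ≤ colNorm T :=
  (norm_nonneg _).trans (norm_col_le_colNorm T 0)

lemma norm_sq_eq_sum_col (T : Seq D N) : ‖T‖ ^ 2 = ∑ i, ‖col T i‖ ^ 2 := by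
  simp only [EuclideanSpace.norm_sq_eq, col]
  rw [Fintype.sum_prod_type, Finset.sum_comm]

/-- The sharp factor is √(N + 1); the cruder one avoids roots and only enlarges the final constant.
-/
lemma norm_le_colNorm (T : Seq D N) : ‖T‖ ≤ (N + 1) * colNorm T := by
  have h0 := colNorm_nonneg T
  refine abs_le_of_sq_le_sq' ?_ (by positivity) |>.2
  rw [norm_sq_eq_sum_col]
  calc ∑ i, ‖col T i‖ ^ 2 ≤ ∑ _i : Fin (N + 1), colNorm T ^ 2 :=
        Finset.sum_le_sum fun i _ => by
          have := norm_col_le_colNorm T i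
          gcongr
    _ = (N + 1) * colNorm T ^ 2 := by simp
    _ ≤ ((N + 1) * colNorm T) ^ 2 := by
        rw [mul_pow]
        gcongr
        nlinarith [(Nat.cast_nonneg N : (0 : ℝ) ≤ N)]

lemma norm_col_le_norm (T : Seq D N) (i : Fin (N + 1)) : ‖col T i‖ ≤ ‖T‖ := by
  refine abs_le_of_sq_le_sq' ?_ (norm_nonneg _) |>.2
  rw [norm_sq_eq_sum_col]
  exact Finset.single_le_sum (f := fun i => ‖col T i‖ ^ 2) (fun _ _ => by positivity)
    (Finset.mem_univ i)

lemma colNorm_le_norm (T : Seq D N) : colNorm T ≤ ‖T‖ :=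
  colNorm_le_of_forall fun i => norm_col_le_norm T i

lemma colNorm_add_le (T T' : Seq D N) : colNorm (T + T') ≤ colNorm T + colNorm T' :=
  colNorm_le_of_forall fun i =>
    calc ‖col (T + T') i‖ = ‖col T i + col T' i‖ := by
          rw [← colL_apply, map_add]; rfl
      _ ≤ _ := (norm_add_le _ _).trans
          (add_le_add (norm_col_le_colNorm T i) (norm_col_le_colNorm T' i))

lemma colNorm_smul_le (c : ℝ) (T : Seq D N) : colNorm (c • T) ≤ |c| * colNorm T :=
  colNorm_le_of_forall fun i =>
    calc ‖col (c • T) i‖ = |c| * ‖col T i‖ := by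
          rw [← colL_apply, map_smul, norm_smul]; rfl
      _ ≤ _ := mul_le_mul_of_nonneg_left (norm_col_le_colNorm T i) (abs_nonneg c)

lemma colNorm_zero : colNorm (0 : Seq D N) = 0 :=
  le_antisymm ((colNorm_le_norm _).trans norm_zero.le) (colNorm_nonneg _)

lemma continuous_colNorm : Continuous (colNorm : Seq D N → ℝ) := by
  refine LipschitzWith.continuous (K := 1) (LipschitzWith.of_le_add fun x y => ?_)
  calc colNorm x = colNorm (y + (x - y)) := by rw [add_sub_cancel]
    _ ≤ colNorm y + colNorm (x - y) := colNorm_add_le _ _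
    _ ≤ colNorm y + dist x y := by
        rw [dist_eq_norm]; gcongr; exact colNorm_le_norm _

lemma abs_apply_le_colNorm (T : Seq D N) (x : Fin D × Fin (N + 1)) : |T x| ≤ colNorm T :=
  (PiLp.norm_apply_le (col T x.2) x.1).trans (norm_col_le_colNorm T x.2)

lemma abs_read_le_colNorm (a : Fin D) (T : Seq D N) : |read a T| ≤ colNorm T :=
  abs_apply_le_colNorm T _

lemma abs_read_sub_le (a : Fin D) (T T' : Seq D N) : |read a T - read a T'| ≤ ‖T - T'‖ :=
  PiLp.norm_apply_le (T - T') (a, Fin.last N)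

lemma continuous_read (a : Fin D) : Continuous (read a : Seq D N → ℝ) := by
  unfold read; fun_prop

/-! ### Clamping the entries of a matrix -/

/-- The matrix with all entries clamped to `[-R, R]`. -/
def clamp (R : ℝ) (T : Seq D N) : Seq D N := WithLp.toLp 2 fun x => max (-R) (min R (T x))

lemma clamp_eq_self {R : ℝ} {T : Seq D N} (h : colNorm T ≤ R) : clamp R T = T := by
  ext x
  obtain ⟨h1, h2⟩ := abs_le.1 ((abs_apply_le_colNorm T x).trans h)
  simp [clamp, h1, h2]

lemma norm_le_of_abs_le {ι : Type*} [Fintype ι] {x y : EuclideanSpace ℝ ι}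
    (h : ∀ i, |x i| ≤ |y i|) : ‖x‖ ≤ ‖y‖ := by
  refine abs_le_of_sq_le_sq' ?_ (norm_nonneg _) |>.2
  simp only [EuclideanSpace.norm_sq_eq]
  exact Finset.sum_le_sum fun i _ => pow_le_pow_left₀ (norm_nonneg _) (h i) 2

lemma abs_clamp_sub_le {R : ℝ} (x y : ℝ) :
    |max (-R) (min R x) - max (-R) (min R y)| ≤ |x - y| := by
  have h1 := abs_max_sub_max_le_max (-R) (min R x) (-R) (min R y)
  have h2 := abs_min_sub_min_le_max R x R y
  simp only [sub_self, abs_zero] at h1 h2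
  rw [max_eq_right (a := (0 : ℝ)) (abs_nonneg _)] at h1 h2
  exact h1.trans h2

lemma norm_clamp_sub_le (R : ℝ) (T T' : Seq D N) : ‖clamp R T - clamp R T'‖ ≤ ‖T - T'‖ :=
  norm_le_of_abs_le fun x => abs_clamp_sub_le (T x) (T' x)

/-- Clamping therefore preserves linear growth of a drift in the column norm, so the a priori bound
for solutions also holds for the clamped equation. -/
lemma colNorm_clamp_le {R : ℝ} (hR : 0 ≤ R) (T : Seq D N) : colNorm (clamp R T) ≤ colNorm T := by
  refine colNorm_le_of_forall fun i => le_trans ?_ (norm_col_le_colNorm T i)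
  refine norm_le_of_abs_le fun a => ?_
  have := abs_clamp_sub_le (R := R) (T (a, i)) 0
  simpa [hR, col, clamp] using this

lemma norm_clamp_le {R : ℝ} (hR : 0 ≤ R) (T : Seq D N) :
    ‖clamp R T‖ ≤ ‖(WithLp.toLp 2 fun _ => R : Seq D N)‖ :=
  norm_le_of_abs_le fun x => by
    simp only [clamp]
    rw [abs_of_nonneg hR, abs_le]
    exact ⟨le_max_left _ _, max_le (by linarith) (min_le_left _ _)⟩

/-! ### Grönwall's inequality in integral form -/

/-- The majorant `v` times exp(-∫ m) is nonincreasing, since its derivative is m (u - v) exp(-∫ m).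
Neither `A` nor `u` needs a sign. -/
lemma le_mul_exp_of_le_add_integral {u m : ℝ → ℝ} {A : ℝ} (hu : Continuous u) (hm : Continuous m)
    (hm0 : ∀ t, 0 ≤ m t)
    (h : ∀ t ∈ Icc (0 : ℝ) 1, u t ≤ A + ∫ s in (0 : ℝ)..t, m s * u s)
    {t : ℝ} (ht : t ∈ Icc (0 : ℝ) 1) :
    u t ≤ A * Real.exp (∫ s in (0 : ℝ)..t, m s) := by
  set V : ℝ → ℝ := fun t => ∫ s in (0 : ℝ)..t, m s with hV
  set v : ℝ → ℝ := fun t => A + ∫ s in (0 : ℝ)..t, m s * u s with hv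
  have dV : ∀ t, HasDerivAt V (m t) t := fun t =>
    intervalIntegral.integral_hasDerivAt_right (hm.intervalIntegrable _ _)
      hm.aestronglyMeasurable.stronglyMeasurableAtFilter hm.continuousAt
  have dv : ∀ t, HasDerivAt v (m t * u t) t := fun t =>
    (intervalIntegral.integral_hasDerivAt_right ((hm.mul hu).intervalIntegrable _ _)
      (hm.mul hu).aestronglyMeasurable.stronglyMeasurableAtFilter
      (hm.mul hu).continuousAt).const_add A
  have dw : ∀ t, HasDerivAt (fun t => v t * Real.exp (-V t))
      (m t * u t * Real.exp (-V t) + v t * (Real.exp (-V t) * -m t)) t := fun t =>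
    (dv t).mul ((dV t).neg.exp)
  have anti : AntitoneOn (fun t => v t * Real.exp (-V t)) (Icc 0 1) := by
    refine antitoneOn_of_deriv_nonpos (convex_Icc 0 1)
      (fun t _ => (dw t).continuousAt.continuousWithinAt)
      (fun t _ => (dw t).differentiableAt.differentiableWithinAt) fun t ht => ?_
    rw [interior_Icc] at ht
    rw [(dw t).deriv]
    have h1 : u t ≤ v t := h t ⟨ht.1.le, ht.2.le⟩
    have h2 := mul_nonneg (hm0 t) (Real.exp_pos (-V t)).le
    nlinarith
  have h0 := anti (left_mem_Icc.2 zero_le_one) ht ht.1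
  simp only [hv, hV, intervalIntegral.integral_same, neg_zero, Real.exp_zero, add_zero,
    mul_one] at h0
  calc u t ≤ v t := h t ht
    _ = v t * Real.exp (-V t) * Real.exp (V t) := by
        rw [mul_assoc, ← Real.exp_add]; simp
    _ ≤ A * Real.exp (V t) := by gcongr

/-! ### Differential equations of Transformer type -/

/-- A time-dependent drift on sequences that grows linearly in the column norm and is Lipschitz on
bounded sets, both with a time-dependent factor `m` of total mass one on `[0, 1]`. -/
structure IsTransformerDrift (κ : ℝ) (ℓ : ℝ → ℝ) (m : ℝ → ℝ) (b : ℝ → Seq D N → Seq D N) :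
    Prop where
  nonneg_growth : 0 ≤ κ
  nonneg_lip : ∀ R, 0 ≤ ℓ R
  continuous_mass : Continuous m
  nonneg_mass : ∀ t, 0 ≤ m t
  integral_mass : ∫ t in (0 : ℝ)..1, m t = 1
  continuous_time : ∀ Z, Continuous fun t => b t Z
  colNorm_le : ∀ t Z, colNorm (b t Z) ≤ κ * m t * colNorm Z
  lipschitz : ∀ R t Z Z', ‖Z‖ ≤ R → ‖Z'‖ ≤ R → ‖b t Z - b t Z'‖ ≤ ℓ R * m t * ‖Z - Z'‖

/-- A continuous curve on the line that solves the integral equation with drift `b` on `[0, 1]`. -/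
structure IsIntegralSolution (b : ℝ → Seq D N → Seq D N) (H : Seq D N) (X : ℝ → Seq D N) :
    Prop where
  continuous : Continuous X
  eq_integral : ∀ t ∈ Icc (0 : ℝ) 1, X t = H + ∫ s in (0 : ℝ)..t, b s (X s)

namespace IsTransformerDrift

variable {κ : ℝ} {ℓ m : ℝ → ℝ} {b : ℝ → Seq D N → Seq D N}

lemma integral_mass_le (hb : IsTransformerDrift κ ℓ m b) {t : ℝ} (ht : t ∈ Icc (0 : ℝ) 1) :
    ∫ s in (0 : ℝ)..t, m s ≤ 1 := by
  rw [← hb.integral_mass]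
  exact intervalIntegral.integral_mono_interval le_rfl ht.1 ht.2
    (Filter.Eventually.of_forall hb.nonneg_mass) (hb.continuous_mass.intervalIntegrable _ _)

/-- Continuity in time at a fixed state combines with a Lipschitz bound in the state that is locally
uniform in time; the ball of radius ‖Z‖ + 1 contains all nearby states. -/
lemma continuous_uncurry (hb : IsTransformerDrift κ ℓ m b) :
    Continuous fun z : ℝ × Seq D N => b z.1 z.2 := by
  rw [continuous_iff_continuousAt]
  rintro ⟨t, Z⟩
  have hm := hb.continuous_mass
  have ht := hb.continuous_time Z
  have key : Filter.Tendsto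
      (fun z : ℝ × Seq D N => ℓ (‖Z‖ + 1) * m z.1 * ‖z.2 - Z‖ + ‖b z.1 Z - b t Z‖)
      (nhds (t, Z)) (nhds 0) := by
    have hc : Continuous fun z : ℝ × Seq D N =>
        ℓ (‖Z‖ + 1) * m z.1 * ‖z.2 - Z‖ + ‖b z.1 Z - b t Z‖ := by fun_prop
    simpa using hc.tendsto (t, Z)
  rw [ContinuousAt, tendsto_iff_norm_sub_tendsto_zero]
  refine squeeze_zero' (Filter.Eventually.of_forall fun _ => norm_nonneg _) ?_ key
  have hn : ∀ᶠ z : ℝ × Seq D N in nhds (t, Z), ‖z.2‖ < ‖Z‖ + 1 :=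
    (continuous_snd.norm.tendsto (t, Z)).eventually (gt_mem_nhds (by simp))
  filter_upwards [hn] with z hz
  calc ‖b z.1 z.2 - b t Z‖ = ‖(b z.1 z.2 - b z.1 Z) + (b z.1 Z - b t Z)‖ := by
        rw [sub_add_sub_cancel]
    _ ≤ _ := (norm_add_le _ _).trans <| by
        gcongr
        exact hb.lipschitz _ _ _ _ hz.le (by linarith)

lemma continuous_comp (hb : IsTransformerDrift κ ℓ m b) {X : ℝ → Seq D N} (hX : Continuous X) :
    Continuous fun t => b t (X t) :=
  hb.continuous_uncurry.comp (continuous_id.prodMk hX)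

lemma colNorm_integral_le {v : ℝ → Seq D N} {w : ℝ → ℝ} (hv : Continuous v) (hw : Continuous w)
    {s t : ℝ} (hst : s ≤ t) (h : ∀ x ∈ Icc s t, colNorm (v x) ≤ w x) :
    colNorm (∫ x in s..t, v x) ≤ ∫ x in s..t, w x := by
  refine colNorm_le_of_forall fun i => ?_
  rw [← colL_apply, ← (colL i).intervalIntegral_comp_comm (hv.intervalIntegrable _ _)]
  refine intervalIntegral.norm_integral_le_of_norm_le hst
    (Filter.Eventually.of_forall fun x hx => ?_) (hw.intervalIntegrable _ _)
  exact (norm_col_le_colNorm _ i).trans (h x ⟨hx.1.le, hx.2⟩)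

/-- Solutions stay bounded in the column norm. -/
lemma colNorm_solution_le (hb : IsTransformerDrift κ ℓ m b) {H : Seq D N} {X : ℝ → Seq D N}
    (hX : IsIntegralSolution b H X) {t : ℝ} (ht : t ∈ Icc (0 : ℝ) 1) :
    colNorm (X t) ≤ colNorm H * Real.exp κ := by
  have hm := hb.continuous_mass
  have hXc := hX.continuous
  have hcX : Continuous fun t => colNorm (X t) := continuous_colNorm.comp hXc
  have h := le_mul_exp_of_le_add_integral (A := colNorm H) (m := fun s => κ * m s) hcX
    (by fun_prop) (fun t => mul_nonneg hb.nonneg_growth (hb.nonneg_mass t))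
    (fun t ht => by
      rw [hX.eq_integral t ht]
      refine (colNorm_add_le _ _).trans (add_le_add_right ?_ _)
      exact colNorm_integral_le (hb.continuous_comp hXc) (by fun_prop) ht.1
        fun x _ => hb.colNorm_le _ _) ht
  refine h.trans (mul_le_mul_of_nonneg_left (Real.exp_le_exp.2 ?_) (colNorm_nonneg H))
  rw [intervalIntegral.integral_const_mul]
  exact mul_le_of_le_one_right hb.nonneg_growth (hb.integral_mass_le ht)

/-- Solutions depend on the initial value in a Lipschitz manner. -/
lemma norm_solution_sub_le (hb : IsTransformerDrift κ ℓ m b) {H H' : Seq D N}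
    {X X' : ℝ → Seq D N} (hX : IsIntegralSolution b H X) (hX' : IsIntegralSolution b H' X')
    {R : ℝ} (hR : ∀ t ∈ Icc (0 : ℝ) 1, ‖X t‖ ≤ R) (hR' : ∀ t ∈ Icc (0 : ℝ) 1, ‖X' t‖ ≤ R)
    {t : ℝ} (ht : t ∈ Icc (0 : ℝ) 1) :
    ‖X t - X' t‖ ≤ ‖H - H'‖ * Real.exp (ℓ R) := by
  have hm := hb.continuous_mass
  have hXc := hX.continuous
  have hXc' := hX'.continuous
  have hi := (hb.continuous_comp hXc).intervalIntegrable (μ := volume) 0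
  have hi' := (hb.continuous_comp hXc').intervalIntegrable (μ := volume) 0
  have h := le_mul_exp_of_le_add_integral (u := fun t => ‖X t - X' t‖) (A := ‖H - H'‖)
    (m := fun s => ℓ R * m s) (by fun_prop)
    (by fun_prop) (fun t => mul_nonneg (hb.nonneg_lip R) (hb.nonneg_mass t))
    (fun t ht => by
      rw [hX.eq_integral t ht, hX'.eq_integral t ht, add_sub_add_comm,
        ← intervalIntegral.integral_sub (hi t) (hi' t)]
      refine (norm_add_le _ _).trans (add_le_add_right ?_ _)
      refine intervalIntegral.norm_integral_le_of_norm_le ht.1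
        (Filter.Eventually.of_forall fun x hx => ?_)
        (Continuous.intervalIntegrable (by fun_prop) _ _)
      have hx' : x ∈ Icc (0 : ℝ) 1 := ⟨hx.1.le, hx.2.trans ht.2⟩
      exact hb.lipschitz _ _ _ _ (hR x hx') (hR' x hx')) ht
  refine h.trans (mul_le_mul_of_nonneg_left (Real.exp_le_exp.2 ?_) (norm_nonneg _))
  rw [intervalIntegral.integral_const_mul]
  exact mul_le_of_le_one_right (hb.nonneg_lip R) (hb.integral_mass_le ht)

/-- A solution of the differential equation on `[0, 1]`, extended by constants, solves the integral
equation. -/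
lemma isIntegralSolution (hb : IsTransformerDrift κ ℓ m b) {H : Seq D N} {T : ℝ → Seq D N}
    (h0 : T 0 = H)
    (hT : ∀ t ∈ Icc (0 : ℝ) 1, HasDerivWithinAt T (b t (T t)) (Icc 0 1) t) :
    IsIntegralSolution b H (IccExtend (zero_le_one' ℝ) fun t : Icc (0 : ℝ) 1 => T t) := by
  have hTc : ContinuousOn T (Icc 0 1) := fun t ht => (hT t ht).continuousWithinAt
  have hXc : Continuous (IccExtend (zero_le_one' ℝ) fun t : Icc (0 : ℝ) 1 => T t) :=
    continuous_IccExtend_iff.2 hTc.domRestrict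
  refine ⟨hXc, fun t ht => ?_⟩
  have e : ∀ s ∈ Icc (0 : ℝ) 1, IccExtend (zero_le_one' ℝ) (fun t : Icc (0 : ℝ) 1 => T t) s = T s :=
    fun s hs => IccExtend_of_mem _ _ hs
  have := intervalIntegral.integral_eq_sub_of_hasDeriv_right_of_le (f := T)
    (f' := fun s => b s (IccExtend (zero_le_one' ℝ) (fun t : Icc (0 : ℝ) 1 => T t) s)) ht.1
    (hTc.mono (Icc_subset_Icc_right ht.2)) (fun s hs => by
      have hs' : s ∈ Icc (0 : ℝ) 1 := ⟨hs.1.le, hs.2.le.trans ht.2⟩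
      simp only [e s hs']
      exact ((hT s hs').hasDerivAt (Icc_mem_nhds hs.1 (hs.2.trans_le ht.2))).hasDerivWithinAt)
    ((hb.continuous_comp hXc).intervalIntegrable _ _)
  rw [this, e t ht, h0, add_sub_cancel]

/-- The clamped states lie in a fixed ball, so one Lipschitz constant serves all radii. -/
lemma comp_clamp (hb : IsTransformerDrift κ ℓ m b) {R : ℝ} (hR : 0 ≤ R) :
    IsTransformerDrift κ (fun _ => ℓ ‖(WithLp.toLp 2 fun _ => R : Seq D N)‖) m
      (fun t Z => b t (clamp R Z)) where
  nonneg_growth := hb.nonneg_growth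
  nonneg_lip _ := hb.nonneg_lip _
  continuous_mass := hb.continuous_mass
  nonneg_mass := hb.nonneg_mass
  integral_mass := hb.integral_mass
  continuous_time _ := hb.continuous_time _
  colNorm_le t Z := (hb.colNorm_le t _).trans <|
    mul_le_mul_of_nonneg_left (colNorm_clamp_le hR Z)
      (mul_nonneg hb.nonneg_growth (hb.nonneg_mass t))
  lipschitz _ t Z Z' _ _ :=
    (hb.lipschitz _ t _ _ (norm_clamp_le hR Z) (norm_clamp_le hR Z')).trans <|
      mul_le_mul_of_nonneg_left (norm_clamp_sub_le R Z Z')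
        (mul_nonneg (hb.nonneg_lip _) (hb.nonneg_mass t))

/-- Global existence on `[0, 1]`. -/
lemma exists_solution (hb : IsTransformerDrift κ ℓ m b) (H : Seq D N) :
    ∃ T : ℝ → Seq D N, T 0 = H ∧
      ∀ t ∈ Icc (0 : ℝ) 1, HasDerivWithinAt T (b t (T t)) (Icc 0 1) t := by
  -- The a priori bound of `colNorm_solution_le`: at this level the clamp is invisible to solutions
  -- started at `H`.
  set R := colNorm H * Real.exp κ
  have hR : 0 ≤ R := mul_nonneg (colNorm_nonneg H) (Real.exp_pos κ).le
  have hc := hb.comp_clamp hR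
  set S := ‖(WithLp.toLp 2 fun _ => R : Seq D N)‖
  obtain ⟨A, hA⟩ := isCompact_Icc.exists_bound_of_continuousOn
    (hb.continuous_mass.continuousOn (s := Icc (0 : ℝ) 1))
  have hmA : ∀ t ∈ Icc (0 : ℝ) 1, m t ≤ |A| := fun t ht =>
    (le_abs_self _).trans ((hA t ht).trans (le_abs_self _))
  set V : ℝ := (N + 1) * (κ * |A| * S)
  have hV : 0 ≤ V := by have := hb.nonneg_growth; positivity
  -- The clamped drift has speed at most `V` on [0, 1], so a solution started at `H` stays within
  -- distance `V` and exists on the whole interval.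
  have hPL : IsPicardLindelof (fun t Z => b t (clamp R Z))
      (⟨0, left_mem_Icc.2 zero_le_one⟩ : Icc (0 : ℝ) 1) H V.toNNReal 0 V.toNNReal
      (ℓ S * |A|).toNNReal := by
    refine ⟨fun t ht => ?_, fun Z _ => (hb.continuous_time _).continuousOn, fun t ht Z _ => ?_, ?_⟩
    · refine LipschitzOnWith.of_dist_le_mul fun Z _ Z' _ => ?_
      rw [Real.coe_toNNReal _ (mul_nonneg (hb.nonneg_lip _) (abs_nonneg _)), dist_eq_norm,
        dist_eq_norm]
      refine (hc.lipschitz _ t Z Z' (le_max_left _ _) (le_max_right _ _)).trans ?_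
      have := hb.nonneg_lip S
      have := hmA t ht
      gcongr
    · rw [Real.coe_toNNReal _ hV]
      refine (norm_le_colNorm _).trans ?_
      have h1 := hb.colNorm_le t (clamp R Z)
      have h2 : colNorm (clamp R Z) ≤ S := (colNorm_le_norm _).trans (norm_clamp_le hR Z)
      have := hmA t ht
      have := hb.nonneg_growth
      have := hb.nonneg_mass t
      refine mul_le_mul_of_nonneg_left (h1.trans ?_) (by positivity)
      gcongr
      exact colNorm_nonneg _
    · simp
  obtain ⟨T, h0, hT⟩ := hPL.exists_eq_forall_mem_Icc_hasDerivWithinAt₀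
  refine ⟨T, h0, fun t ht => ?_⟩
  -- The solution of the clamped equation never reaches the clamping level, so it solves the
  -- original one.
  have h1 := hc.colNorm_solution_le (hc.isIntegralSolution h0 hT) ht
  rw [IccExtend_of_mem _ _ ht] at h1
  have h2 : HasDerivWithinAt T (b t (clamp R (T t))) (Icc 0 1) t := hT t ht
  rwa [clamp_eq_self (T := T t) h1] at h2

end IsTransformerDrift

/-! ### Encoders on bounded parameters -/

/-- The growth rate of an encoder in the column norm, for parameters in the ball of radius `r`. -/
def growthRate (K r : ℝ) : ℝ := K * (1 + r + r ^ 2)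

/-- The Lipschitz constant of an encoder on the ball of radius `R`, for parameters in the ball of
radius `r`. -/
def lipConst (φT : ℝ → ℝ) (r R : ℝ) : ℝ := |φT R| * (1 + r + r ^ 2)

lemma growthRate_nonneg {K r : ℝ} (hK : 0 < K) (hr : 0 < r) : 0 ≤ growthRate K r := by
  unfold growthRate; positivity

lemma lipConst_nonneg (φT : ℝ → ℝ) {r : ℝ} (hr : 0 < r) (R : ℝ) : 0 ≤ lipConst φT r R := by
  unfold lipConst; positivity

namespace ParticleGrowth

variable {K r : ℝ} {φP φT : ℝ → ℝ} {f : Seq D N → Vec p → Seq D N} {h : Seq D N → Vec q → Seq D N}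

lemma colNorm_le_growthRate (hf : ParticleGrowth K φP φT f) (hK : 0 < K) (T : Seq D N)
    {θ : Vec p} (hθ : ‖θ‖ ≤ r) : colNorm (f T θ) ≤ growthRate K r * colNorm T := by
  refine (hf.colNorm_le T θ).trans ?_
  have := colNorm_nonneg T
  calc K * colNorm T * (1 + ‖θ‖ + ‖θ‖ ^ 2) ≤ K * colNorm T * (1 + r + r ^ 2) := by gcongr
    _ = _ := by unfold growthRate; ring

lemma norm_sub_le (hf : ParticleGrowth K φP φT f) (hφT : IsGrowthFunction φT) {R : ℝ}
    {θ : Vec p} (hθ : ‖θ‖ ≤ r) {T T' : Seq D N} (hT : ‖T‖ ≤ R) (hT' : ‖T'‖ ≤ R) :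
    ‖f T θ - f T' θ‖ ≤ lipConst φT r R * ‖T - T'‖ := by
  refine Convex.norm_image_sub_le_of_norm_fderiv_le (𝕜 := ℝ) (f := fun T => f T θ)
    (s := Metric.closedBall 0 R) (fun x _ => hf.differentiable_input θ x) (fun x hx => ?_)
    (convex_closedBall _ _) (by simpa using hT') (by simpa using hT)
  rw [mem_closedBall_zero_iff] at hx
  have h1 : φT ‖x‖ ≤ |φT R| :=
    (hφT.2 (norm_nonneg x) ((norm_nonneg x).trans hx) hx).trans (le_abs_self _)
  refine (hf.grad_input_le x θ).trans ?_
  unfold lipConst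
  gcongr

lemma continuous_param (hf : ParticleGrowth K φP φT f) (T : Seq D N) : Continuous (f T) :=
  (hf.differentiable_param T).continuous

lemma continuous_input (hf : ParticleGrowth K φP φT f) (θ : Vec p) :
    Continuous fun T => f T θ :=
  (hf.differentiable_input θ).continuous

/-- The gradient bound in the parameter is columnwise, so the mean value inequality is applied to
each column; passing to the Frobenius norm costs N + 1. -/
lemma norm_param_sub_le (hf : ParticleGrowth K φP φT f) (T : Seq D N) {θ θ' : Vec p}
    (hθ : ‖θ‖ ≤ r) (hθ' : ‖θ'‖ ≤ r) :
    ‖f T θ - f T θ'‖ ≤ (N + 1) * (|φP (colNorm T)| * (1 + r) * ‖θ - θ'‖) := by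
  refine (norm_le_colNorm _).trans (mul_le_mul_of_nonneg_left ?_ (by positivity))
  refine colNorm_le_of_forall fun i => ?_
  have := Convex.norm_image_sub_le_of_norm_fderiv_le (𝕜 := ℝ) (f := fun θ => col (f T θ) i)
    (s := Metric.closedBall 0 r) (x := θ') (y := θ) (C := |φP (colNorm T)| * (1 + r))
    (fun x _ => (colL i).differentiableAt.comp x (hf.differentiable_param T x))
    (fun x hx => ?_) (convex_closedBall _ _) (by simpa using hθ') (by simpa using hθ)
  · exact this
  · rw [mem_closedBall_zero_iff] at hx
    refine (hf.grad_param_le T x i).trans ?_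
    gcongr
    exact le_abs_self _

end ParticleGrowth

/-! ### The drift of a single particle -/

/-- The average of the two encoders at a particle. -/
def drift (f : Seq D N → Vec p → Seq D N) (h : Seq D N → Vec q → Seq D N) (Z : Seq D N)
    (β : Particle p q) : Seq D N :=
  (1 / 2 : ℝ) • (f Z β.fst + h Z β.snd)

lemma mem_closedBall_iff_sq {r : ℝ} (hr : 0 < r) (β : Particle p q) :
    β ∈ Metric.closedBall 0 r ↔ ‖β.fst‖ ^ 2 + ‖β.snd‖ ^ 2 ≤ r ^ 2 := by
  rw [mem_closedBall_zero_iff, ← WithLp.prod_norm_sq_eq_of_L2,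
    sq_le_sq₀ (norm_nonneg _) hr.le]

lemma norm_fst_le_norm (β : Particle p q) : ‖β.fst‖ ≤ ‖β‖ := by
  refine abs_le_of_sq_le_sq' ?_ (norm_nonneg _) |>.2
  rw [WithLp.prod_norm_sq_eq_of_L2]
  nlinarith [sq_nonneg ‖β.snd‖]

lemma norm_snd_le_norm (β : Particle p q) : ‖β.snd‖ ≤ ‖β‖ := by
  refine abs_le_of_sq_le_sq' ?_ (norm_nonneg _) |>.2
  rw [WithLp.prod_norm_sq_eq_of_L2]
  nlinarith [sq_nonneg ‖β.fst‖]

lemma norm_half_smul_add_le {E : Type*} [NormedAddCommGroup E] [NormedSpace ℝ E] {x y : E} {c : ℝ}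
    (hx : ‖x‖ ≤ c) (hy : ‖y‖ ≤ c) : ‖(1 / 2 : ℝ) • (x + y)‖ ≤ c := by
  rw [norm_smul, Real.norm_of_nonneg (by norm_num)]
  linarith [norm_add_le x y]

section Drift

variable {K r : ℝ} {φP φT : ℝ → ℝ} {f : Seq D N → Vec p → Seq D N} {h : Seq D N → Vec q → Seq D N}

lemma continuous_drift_particle (hf : ParticleGrowth K φP φT f) (hh : ParticleGrowth K φP φT h)
    (Z : Seq D N) : Continuous (drift f h Z) :=
  (((hf.continuous_param Z).comp (by fun_prop)).add
    ((hh.continuous_param Z).comp (by fun_prop))).const_smul (1 / 2 : ℝ)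

lemma continuous_drift_input (hf : ParticleGrowth K φP φT f) (hh : ParticleGrowth K φP φT h)
    (β : Particle p q) : Continuous fun Z => drift f h Z β :=
  ((hf.continuous_input _).add (hh.continuous_input _)).const_smul (1 / 2 : ℝ)

lemma colNorm_drift_le (hf : ParticleGrowth K φP φT f) (hh : ParticleGrowth K φP φT h)
    (hK : 0 < K) (Z : Seq D N) {β : Particle p q} (hβ : β ∈ Metric.closedBall 0 r) :
    colNorm (drift f h Z β) ≤ growthRate K r * colNorm Z := by
  rw [mem_closedBall_zero_iff] at hβ
  have h1 := hf.colNorm_le_growthRate hK Z ((norm_fst_le_norm β).trans hβ)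
  have h2 := hh.colNorm_le_growthRate hK Z ((norm_snd_le_norm β).trans hβ)
  refine (colNorm_smul_le _ _).trans ?_
  rw [abs_of_nonneg (by norm_num)]
  linarith [colNorm_add_le (f Z β.fst) (h Z β.snd)]

lemma norm_drift_sub_le (hf : ParticleGrowth K φP φT f) (hh : ParticleGrowth K φP φT h)
    (hφT : IsGrowthFunction φT) {R : ℝ} {β : Particle p q} (hβ : β ∈ Metric.closedBall 0 r)
    {Z Z' : Seq D N} (hZ : ‖Z‖ ≤ R) (hZ' : ‖Z'‖ ≤ R) :
    ‖drift f h Z β - drift f h Z' β‖ ≤ lipConst φT r R * ‖Z - Z'‖ := by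
  rw [mem_closedBall_zero_iff] at hβ
  unfold drift
  rw [← smul_sub, add_sub_add_comm]
  exact norm_half_smul_add_le (hf.norm_sub_le hφT ((norm_fst_le_norm β).trans hβ) hZ hZ')
    (hh.norm_sub_le hφT ((norm_snd_le_norm β).trans hβ) hZ hZ')

/-- This makes the drift a legitimate integrand for the bounded Lipschitz distance. The constant
depends on `Z` and serves only to prove continuity in time. -/
lemma exists_lipschitzOnWith_drift (hf : ParticleGrowth K φP φT f)
    (hh : ParticleGrowth K φP φT h) (hr : 0 < r) (Z : Seq D N) :
    ∃ C : NNReal, LipschitzOnWith C (drift f h Z) (Metric.closedBall 0 r) := by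
  set A := |φP (colNorm Z)| * (1 + r)
  have hA : 0 ≤ A := by positivity
  refine ⟨((N + 1) * A).toNNReal, LipschitzOnWith.of_dist_le_mul fun β hβ β' hβ' => ?_⟩
  rw [mem_closedBall_zero_iff] at hβ hβ'
  rw [Real.coe_toNNReal _ (by positivity), dist_eq_norm, dist_eq_norm]
  unfold drift
  rw [← smul_sub, add_sub_add_comm]
  refine norm_half_smul_add_le
    ((hf.norm_param_sub_le Z ((norm_fst_le_norm β).trans hβ)
      ((norm_fst_le_norm β').trans hβ')).trans ?_)
    ((hh.norm_param_sub_le Z ((norm_snd_le_norm β).trans hβ)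
      ((norm_snd_le_norm β').trans hβ')).trans ?_)
  · have := norm_fst_le_norm (β - β')
    rw [WithLp.sub_fst] at this
    rw [mul_assoc (_ + _)]
    gcongr
  · have := norm_snd_le_norm (β - β')
    rw [WithLp.sub_snd] at this
    rw [mul_assoc (_ + _)]
    gcongr

end Drift

/-! ### Measures concentrated on a ball -/

section Concentrated

variable {E : Type*} [NormedAddCommGroup E] {r : ℝ}
  {ν : Measure (Particle p q)}

lemma exists_norm_le_on_closedBall {g : Particle p q → E} (hg : Continuous g) (r : ℝ) :
    ∃ A, 0 ≤ A ∧ ∀ β ∈ Metric.closedBall (0 : Particle p q) r, ‖g β‖ ≤ A := by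
  obtain ⟨A, hA⟩ := (isCompact_closedBall (0 : Particle p q) r).exists_bound_of_continuousOn
    hg.continuousOn
  exact ⟨|A|, abs_nonneg A, fun β hβ => (hA β hβ).trans (le_abs_self A)⟩

lemma ae_mem_closedBall (hν : ν (Metric.closedBall 0 r)ᶜ = 0) :
    ∀ᵐ β ∂ν, β ∈ Metric.closedBall (0 : Particle p q) r := by
  rw [ae_iff]; exact hν

lemma integrable_of_closedBall [IsFiniteMeasure ν] (hν : ν (Metric.closedBall 0 r)ᶜ = 0)
    {g : Particle p q → E} (hg : Continuous g) : Integrable g ν := by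
  obtain ⟨A, -, hA⟩ := exists_norm_le_on_closedBall hg r
  exact Integrable.of_bound hg.aestronglyMeasurable A
    ((ae_mem_closedBall hν).mono hA)

lemma norm_integral_le_of_closedBall [NormedSpace ℝ E] [IsFiniteMeasure ν] (hν : ν (Metric.closedBall 0 r)ᶜ = 0)
    {g : Particle p q → E} {A : ℝ} (hA : ∀ β ∈ Metric.closedBall 0 r, ‖g β‖ ≤ A) :
    ‖∫ β, g β ∂ν‖ ≤ A * ν.real univ :=
  norm_integral_le_of_norm_le_const ((ae_mem_closedBall hν).mono hA)

lemma colNorm_integral_le_of_closedBall [IsFiniteMeasure ν]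
    (hν : ν (Metric.closedBall 0 r)ᶜ = 0) {g : Particle p q → Seq D N} (hg : Continuous g) {A : ℝ}
    (hA : ∀ β ∈ Metric.closedBall 0 r, colNorm (g β) ≤ A) :
    colNorm (∫ β, g β ∂ν) ≤ A * ν.real univ :=
  colNorm_le_of_forall fun i => by
    rw [← colL_apply, ← (colL i).integral_comp_comm (integrable_of_closedBall hν hg)]
    exact norm_integral_le_of_closedBall hν
      fun β hβ => (norm_col_le_colNorm _ i).trans (hA β hβ)

lemma integral_sub_le_blDist {ν' : Measure (Particle p q)} [IsFiniteMeasure ν]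
    [IsFiniteMeasure ν'] {φ : Particle p q → ℝ} (hφ : ∀ β, |φ β| ≤ 1) (hφL : LipschitzWith 1 φ) :
    ∫ β, φ β ∂ν - ∫ β, φ β ∂ν' ≤ blDist ν ν' := by
  -- A real `sSup` dominates its members only for a set bounded above; the finite masses of the two
  -- measures supply the bound.
  refine le_csSup ⟨1 * ν.real univ + 1 * ν'.real univ, ?_⟩ ⟨φ, hφ, hφL, rfl⟩
  rintro _ ⟨ψ, hψ, -, rfl⟩
  have h1 := (abs_le.1 (norm_integral_le_of_norm_le_const (μ := ν) (f := ψ)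
    (Filter.Eventually.of_forall hψ))).2
  have h2 := (abs_le.1 (norm_integral_le_of_norm_le_const (μ := ν') (f := ψ)
    (Filter.Eventually.of_forall hψ))).1
  linarith

/-- The bounded Lipschitz distance controls the integrals of functions that are Lipschitz on a ball
on which both measures are concentrated. -/
lemma exists_integral_sub_le_mul_blDist {φ : Particle p q → ℝ} (hφ : Continuous φ) {C : NNReal}
    (hφL : LipschitzOnWith C φ (Metric.closedBall 0 r)) :
    ∃ c : ℝ, 0 < c ∧ ∀ ν ν' : Measure (Particle p q), IsFiniteMeasure ν → IsFiniteMeasure ν' →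
      ν (Metric.closedBall 0 r)ᶜ = 0 → ν' (Metric.closedBall 0 r)ᶜ = 0 →
      ∫ β, φ β ∂ν - ∫ β, φ β ∂ν' ≤ c * blDist ν ν' := by
  obtain ⟨A, hA0, hA⟩ := exists_norm_le_on_closedBall hφ r
  -- A Lipschitz extension from the ball, clamped to [-c, c] and divided by c, is an admissible test
  -- function. It still equals φ / c on the ball, because c exceeds the supremum of |φ| there.
  obtain ⟨ψ, hψL, hψ⟩ := hφL.extend_real
  set c : ℝ := max (C : ℝ) A + 1
  have hc : 0 < c := by positivity
  set χ : Particle p q → ℝ := fun β => c⁻¹ * max (-c) (min c (ψ β)) with hχ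
  have h1 : ∀ β, |χ β| ≤ 1 := fun β => by
    have : |max (-c) (min c (ψ β))| ≤ c :=
      abs_le.2 ⟨le_max_left _ _, max_le (by linarith) (min_le_left _ _)⟩
    rw [hχ, abs_mul, abs_of_pos (inv_pos.2 hc), inv_mul_le_iff₀ hc]
    simpa using this
  have hL : LipschitzWith 1 χ := LipschitzWith.of_dist_le_mul fun β β' => by
    rw [Real.dist_eq, hχ, ← mul_sub, abs_mul, abs_of_pos (inv_pos.2 hc), inv_mul_le_iff₀ hc]
    refine abs_clamp_sub_le _ _ |>.trans ?_
    have h := hψL.dist_le_mul β β'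
    rw [Real.dist_eq] at h
    refine h.trans ?_
    simp only [NNReal.coe_one, one_mul]
    gcongr
    exact (le_max_left _ _).trans (le_add_of_nonneg_right zero_le_one)
  have e : ∀ β ∈ Metric.closedBall (0 : Particle p q) r, φ β = c * χ β := fun β hβ => by
    obtain ⟨h2, h3⟩ := abs_le.1 (hA β hβ)
    have h4 : A ≤ c := (le_max_right _ _).trans (le_add_of_nonneg_right zero_le_one)
    rw [hχ]
    simp only
    rw [← hψ hβ, min_eq_right (by linarith), max_eq_right (by linarith),
      mul_inv_cancel_left₀ hc.ne']
  refine ⟨c, hc, fun ν ν' _ _ hν hν' => ?_⟩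
  rw [integral_congr_ae ((ae_mem_closedBall hν).mono e),
    integral_congr_ae ((ae_mem_closedBall hν').mono e), integral_const_mul c χ,
    integral_const_mul c χ, ← mul_sub]
  exact mul_le_mul_of_nonneg_left (integral_sub_le_blDist h1 hL) hc.le

end Concentrated

/-! ### The slices of a distribution -/

/-- The slices of a distribution, extended from `[0, 1]` to the line by constants. -/
def extendSlices (ρ : Kernel unitInterval (Particle p q)) : Kernel ℝ (Particle p q) :=
  ρ.comap (projIcc 0 1 zero_le_one) continuous_projIcc.measurable

lemma extendSlices_apply (ρ : Kernel unitInterval (Particle p q)) (t : ℝ) :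
    extendSlices ρ t = ρ (projIcc 0 1 zero_le_one t) := rfl

lemma extendSlices_coe (ρ : Kernel unitInterval (Particle p q)) (t : unitInterval) :
    extendSlices ρ t = ρ t := by
  rw [extendSlices_apply, projIcc_val]

lemma integral_unitInterval_eq {E : Type*} [NormedAddCommGroup E] [NormedSpace ℝ E]
    (F : ℝ → E) : ∫ t : unitInterval, F t = ∫ t in (0 : ℝ)..1, F t := by
  rw [intervalIntegral.integral_of_le zero_le_one, ← integral_Icc_eq_integral_Ioc]
  exact integral_subtype_comap measurableSet_Icc F

/-- The mass of the slices. -/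
def sliceMass (ρ : Kernel unitInterval (Particle p q)) (t : ℝ) : ℝ := (extendSlices ρ t).real univ

/-- The right-hand side of the Transformer differential equation. -/
def field (f : Seq D N → Vec p → Seq D N) (h : Seq D N → Vec q → Seq D N)
    (ρ : Kernel unitInterval (Particle p q)) (t : ℝ) (Z : Seq D N) : Seq D N :=
  ∫ β, drift f h Z β ∂(extendSlices ρ t)

section Slices

variable {r : ℝ} {ρ : Kernel unitInterval (Particle p q)}

lemma isFiniteMeasure_extendSlices (hρ : ρ ∈ P2 p q r) (t : ℝ) :
    IsFiniteMeasure (extendSlices ρ t) :=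
  hρ.1.finite_slice _

lemma extendSlices_compl_closedBall (hr : 0 < r) (hρ : ρ ∈ P2 p q r) (t : ℝ) :
    extendSlices ρ t (Metric.closedBall 0 r)ᶜ = 0 := by
  rw [extendSlices_apply, ← hρ.2 (projIcc 0 1 zero_le_one t)]
  congr 2
  ext β
  exact mem_closedBall_iff_sq hr β

/-- This continuity is all that is taken from the Lipschitz condition on the slices, which is why
`Cρ` does not enter the final constant. -/
lemma continuous_integral_slices (hr : 0 < r) (hρ : ρ ∈ P2 p q r) {φ : Particle p q → ℝ}
    (hφ : Continuous φ) {C : NNReal} (hφL : LipschitzOnWith C φ (Metric.closedBall 0 r)) :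
    Continuous fun t => ∫ β, φ β ∂(extendSlices ρ t) := by
  obtain ⟨c, hc, h⟩ := exists_integral_sub_le_mul_blDist hφ hφL
  obtain ⟨Cρ, hCρ, hL⟩ := hρ.1.lipschitz_slice
  have key : ∀ s t : ℝ, ∫ β, φ β ∂(extendSlices ρ s) - ∫ β, φ β ∂(extendSlices ρ t)
      ≤ c * (Cρ * |s - t|) := fun s t =>
    (h _ _ (isFiniteMeasure_extendSlices hρ s) (isFiniteMeasure_extendSlices hρ t)
      (extendSlices_compl_closedBall hr hρ s) (extendSlices_compl_closedBall hr hρ t)).trans <| by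
      refine mul_le_mul_of_nonneg_left ((hL _ _).trans ?_) hc.le
      refine mul_le_mul_of_nonneg_left ?_ hCρ.le
      exact abs_projIcc_sub_projIcc zero_le_one
  refine LipschitzWith.continuous (K := (c * Cρ).toNNReal) (LipschitzWith.of_le_add_mul _ ?_)
  intro s t
  rw [Real.coe_toNNReal _ (by positivity), Real.dist_eq]
  linarith [key s t]

lemma continuous_integral_slices_seq (hr : 0 < r) (hρ : ρ ∈ P2 p q r)
    {g : Particle p q → Seq D N} (hg : Continuous g) {C : NNReal}
    (hgL : LipschitzOnWith C g (Metric.closedBall 0 r)) :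
    Continuous fun t => ∫ β, g β ∂(extendSlices ρ t) := by
  refine (PiLp.continuous_toLp 2 _).comp (f := fun t => (∫ β, g β ∂(extendSlices ρ t)).ofLp)
    (continuous_pi fun x => ?_)
  have e : (fun t => (∫ β, g β ∂(extendSlices ρ t)) x)
      = fun t => ∫ β, g β x ∂(extendSlices ρ t) := by
    funext t
    have := isFiniteMeasure_extendSlices hρ t
    exact ((EuclideanSpace.proj (𝕜 := ℝ) x).integral_comp_comm
      (integrable_of_closedBall (extendSlices_compl_closedBall hr hρ t) hg)).symm
  rw [e]
  refine continuous_integral_slices hr hρ (by fun_prop) (C := C) ?_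
  refine LipschitzOnWith.of_dist_le_mul fun β hβ β' hβ' => ?_
  rw [dist_eq_norm]
  exact (PiLp.norm_apply_le (g β - g β') x).trans
    ((dist_eq_norm (g β) (g β')).symm.le.trans (hgL.dist_le_mul β hβ β' hβ'))

lemma continuous_sliceMass (hr : 0 < r) (hρ : ρ ∈ P2 p q r) : Continuous (sliceMass ρ) := by
  have := continuous_integral_slices hr hρ (φ := fun _ => 1) continuous_const (C := 0)
    (LipschitzOnWith.of_dist_le_mul fun β _ β' _ => by simp)
  simp only [integral_const, smul_eq_mul, mul_one] at this
  exact this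

lemma sliceMass_nonneg (ρ : Kernel unitInterval (Particle p q)) (t : ℝ) : 0 ≤ sliceMass ρ t :=
  measureReal_nonneg

lemma integral_sliceMass (hr : 0 < r) (hρ : ρ ∈ P2 p q r) :
    ∫ t in (0 : ℝ)..1, sliceMass ρ t = 1 := by
  rw [← integral_unitInterval_eq,
    integral_eq_lintegral_of_nonneg_ae (f := fun t : unitInterval => sliceMass ρ t) (Filter.Eventually.of_forall fun t => sliceMass_nonneg ρ t)
      ((continuous_sliceMass hr hρ).comp continuous_subtype_val).aestronglyMeasurable]
  have e : ∀ t : unitInterval, ENNReal.ofReal (sliceMass ρ t) = ρ t univ := fun t => by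
    have := hρ.1.finite_slice t
    rw [sliceMass, extendSlices_coe, ofReal_measureReal]
  simp only [e, hρ.1.total_mass, ENNReal.toReal_one]

variable {K : ℝ} {φP φT : ℝ → ℝ} {f : Seq D N → Vec p → Seq D N} {h : Seq D N → Vec q → Seq D N}

/-- Bounds for a single particle pick up the mass of the slice on integration. That mass is not
bounded uniformly in `ρ`, but its time integral is one. -/
lemma isTransformerDrift_field (hf : ParticleGrowth K φP φT f) (hh : ParticleGrowth K φP φT h)
    (hφT : IsGrowthFunction φT) (hK : 0 < K) (hr : 0 < r) (hρ : ρ ∈ P2 p q r) :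
    IsTransformerDrift (growthRate K r) (lipConst φT r) (sliceMass ρ) (field f h ρ) where
  nonneg_growth := growthRate_nonneg hK hr
  nonneg_lip := lipConst_nonneg φT hr
  continuous_mass := continuous_sliceMass hr hρ
  nonneg_mass := sliceMass_nonneg ρ
  integral_mass := integral_sliceMass hr hρ
  continuous_time Z := by
    obtain ⟨C, hC⟩ := exists_lipschitzOnWith_drift hf hh hr Z
    exact continuous_integral_slices_seq hr hρ (continuous_drift_particle hf hh Z) hC
  colNorm_le t Z := by
    have := isFiniteMeasure_extendSlices hρ t
    refine (colNorm_integral_le_of_closedBall (extendSlices_compl_closedBall hr hρ t)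
      (continuous_drift_particle hf hh Z) fun β hβ => colNorm_drift_le hf hh hK Z hβ).trans ?_
    rw [mul_right_comm]
    rfl
  lipschitz R t Z Z' hZ hZ' := by
    have := isFiniteMeasure_extendSlices hρ t
    have hS := extendSlices_compl_closedBall hr hρ t
    rw [field, field, ← integral_sub
      (integrable_of_closedBall hS (continuous_drift_particle hf hh Z))
      (integrable_of_closedBall hS (continuous_drift_particle hf hh Z'))]
    refine (norm_integral_le_of_closedBall hS
      fun β hβ => norm_drift_sub_le hf hh hφT hβ hZ hZ').trans ?_
    rw [mul_right_comm]
    rfl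

/-- The flow, extended from `[0, 1]` to the line by constants. -/
def extendFlow (f : Seq D N → Vec p → Seq D N) (h : Seq D N → Vec q → Seq D N)
    (ρ : Kernel unitInterval (Particle p q)) (H : Seq D N) : ℝ → Seq D N :=
  IccExtend (zero_le_one' ℝ) fun t : Icc (0 : ℝ) 1 => flow f h ρ H t

lemma extendFlow_eq {t : ℝ} (ht : t ∈ Icc (0 : ℝ) 1) (H : Seq D N) :
    extendFlow f h ρ H t = flow f h ρ H t :=
  IccExtend_of_mem _ _ ht

/-- `flow` is an arbitrary choice among solutions, so existence must be known before it solves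
anything. The later estimates hold for every solution, so uniqueness is not invoked. -/
lemma isIntegralSolution_extendFlow (hf : ParticleGrowth K φP φT f)
    (hh : ParticleGrowth K φP φT h) (hφT : IsGrowthFunction φT) (hK : 0 < K) (hr : 0 < r)
    (hρ : ρ ∈ P2 p q r) (H : Seq D N) :
    IsIntegralSolution (field f h ρ) H (extendFlow f h ρ H) := by
  have hb := isTransformerDrift_field hf hh hφT hK hr hρ
  have hs : SolvesTransformerODE f h ρ H (flow f h ρ H) := by
    obtain ⟨T, h0, hT⟩ := hb.exists_solution H
    refine Classical.epsilon_spec (p := SolvesTransformerODE f h ρ H) ⟨T, h0, fun t => ?_⟩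
    have := hT t t.2
    rw [field, extendSlices_coe] at this
    exact this
  refine hb.isIntegralSolution hs.1 fun t ht => ?_
  have := hs.2 ⟨t, ht⟩
  rw [← extendSlices_coe] at this
  exact this

end Slices

/-! ### Time grids with equal masses -/

/-- The grid consists of quantiles of the cumulative mass, found by the intermediate value theorem.
-/
lemma exists_mass_grid {m : ℝ → ℝ} (hm : Continuous m) (hm0 : ∀ t, 0 ≤ m t)
    (hm1 : ∫ t in (0 : ℝ)..1, m t = 1) {L : ℕ} (hL : 0 < L) :
    ∃ τ : ℕ → ℝ, τ 0 = 0 ∧ τ L = 1 ∧ (∀ k ≤ L, τ k ∈ Icc (0 : ℝ) 1) ∧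
      ∀ k < L, τ k ≤ τ (k + 1) ∧ ∫ t in τ k..τ (k + 1), m t = (L : ℝ)⁻¹ := by
  have hL' : (0 : ℝ) < L := Nat.cast_pos.2 hL
  set V : ℝ → ℝ := fun t => ∫ s in (0 : ℝ)..t, m s
  have hi : ∀ a b, IntervalIntegrable m volume a b := fun a b => hm.intervalIntegrable a b
  have hV : Continuous V := intervalIntegral.continuous_primitive hi 0
  have hV0 : V 0 = 0 := intervalIntegral.integral_same
  have hsub : ∀ a b, ∫ t in a..b, m t = V b - V a := fun a b =>
    (intervalIntegral.integral_interval_sub_left (hi 0 b) (hi 0 a)).symm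
  have hmono : ∀ a b, a ≤ b → V a ≤ V b := fun a b hab => by
    have := intervalIntegral.integral_nonneg (μ := volume) hab fun t _ => hm0 t
    rw [hsub] at this
    linarith
  -- The end points are prescribed separately: the cumulative mass may be flat near 0 or 1, and then
  -- its value does not determine the time. Beyond `L` the value 0 is a dummy.
  have hex : ∀ k : ℕ, ∃ t, k ≤ L → (t ∈ Icc (0 : ℝ) 1 ∧ V t = k / L ∧ (k = 0 → t = 0) ∧
      (k = L → t = 1)) := fun k => by
    rcases Nat.eq_zero_or_pos k with rfl | hk
    · exact ⟨0, fun _ => ⟨left_mem_Icc.2 zero_le_one, by simp [hV0], fun _ => rfl,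
        fun h => absurd h hL.ne⟩⟩
    by_cases hkL : k = L
    · subst hkL
      exact ⟨1, fun _ => ⟨right_mem_Icc.2 zero_le_one, by rw [div_self hL'.ne']; exact hm1,
        fun h => absurd h hL.ne', fun _ => rfl⟩⟩
    by_cases hk' : k ≤ L
    · have hmem : (k / L : ℝ) ∈ Icc (V 0) (V 1) := by
        rw [hV0]
        exact ⟨by positivity, (div_le_one hL').2 (by exact_mod_cast hk') |>.trans_eq hm1.symm⟩
      obtain ⟨t, ht, hVt⟩ := intermediate_value_Icc zero_le_one hV.continuousOn hmem
      exact ⟨t, fun _ => ⟨ht, hVt, fun h => absurd h hk.ne', fun h => absurd h hkL⟩⟩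
    · exact ⟨0, fun h => absurd h hk'⟩
  choose τ hτ using hex
  refine ⟨τ, (hτ 0 hL.le).2.2.1 rfl, (hτ L le_rfl).2.2.2 rfl, fun k hk => (hτ k hk).1,
    fun k hk => ?_⟩
  have h1 := (hτ k hk.le).2.1
  have h2 := (hτ (k + 1) hk).2.1
  have h3 : V (τ (k + 1)) - V (τ k) = (L : ℝ)⁻¹ := by
    rw [h1, h2]; push_cast; field_simp; ring
  refine ⟨?_, (hsub _ _).trans h3⟩
  -- The quantiles are ordered because the cumulative mass is monotone and must rise by 1/L > 0.
  by_contra! hlt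
  have := hmono _ _ hlt.le
  have : (0 : ℝ) < (L : ℝ)⁻¹ := inv_pos.2 hL'
  linarith

/-! ### Averages of slices over a time interval -/

/-- The average of the slices over the time interval `(s, t]`, normalized by the factor `c`. -/
def sliceAverage (ρ : Kernel unitInterval (Particle p q)) (c s t : ℝ) : Measure (Particle p q) :=
  ENNReal.ofReal c • (volume.restrict (Ioc s t)).bind (extendSlices ρ)

section SliceAverage

variable {r c s t : ℝ} {ρ : Kernel unitInterval (Particle p q)}

lemma isProbabilityMeasure_sliceAverage (hr : 0 < r) (hρ : ρ ∈ P2 p q r) (hc : 0 < c)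
    (hst : s ≤ t) (hmass : ∫ x in s..t, sliceMass ρ x = c⁻¹) :
    IsProbabilityMeasure (sliceAverage ρ c s t) := by
  constructor
  have e : ∀ x, extendSlices ρ x univ = ENNReal.ofReal (sliceMass ρ x) := fun x => by
    have := isFiniteMeasure_extendSlices hρ x
    rw [sliceMass, ofReal_measureReal]
  rw [sliceAverage, Measure.smul_apply, Measure.bind_apply .univ (Kernel.aemeasurable _)]
  simp only [e]
  rw [← ofReal_integral_eq_lintegral_ofReal
    ((continuous_sliceMass hr hρ).integrableOn_Ioc)
    (Filter.Eventually.of_forall fun x => sliceMass_nonneg ρ x),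
    ← intervalIntegral.integral_of_le hst, hmass, smul_eq_mul, ← ENNReal.ofReal_mul hc.le,
    mul_inv_cancel₀ hc.ne', ENNReal.ofReal_one]

lemma sliceAverage_compl_closedBall (hr : 0 < r) (hρ : ρ ∈ P2 p q r) :
    sliceAverage ρ c s t (Metric.closedBall 0 r)ᶜ = 0 := by
  rw [sliceAverage, Measure.smul_apply,
    Measure.bind_apply Metric.isClosed_closedBall.measurableSet.compl (Kernel.aemeasurable _)]
  simp only [extendSlices_compl_closedBall hr hρ, lintegral_zero, smul_zero]

/-- With c = L, the field at a frozen state integrates over a grid interval to exactly 1/L times its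
mean under a probability measure, so averaging the slices causes no error of its own. -/
lemma integral_sliceAverage {E : Type*} [NormedAddCommGroup E] [NormedSpace ℝ E]
    (hr : 0 < r) (hρ : ρ ∈ P2 p q r) (hc : 0 < c) (hst : s ≤ t)
    (hmass : ∫ x in s..t, sliceMass ρ x = c⁻¹) {g : Particle p q → E} (hg : Continuous g) :
    ∫ β, g β ∂(sliceAverage ρ c s t) = c • ∫ x in s..t, ∫ β, g β ∂(extendSlices ρ x) := by
  have hp := isProbabilityMeasure_sliceAverage hr hρ hc hst hmass
  have hi : Integrable g (sliceAverage ρ c s t) :=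
    integrable_of_closedBall (sliceAverage_compl_closedBall hr hρ) hg
  have hc0 : ENNReal.ofReal c ≠ 0 := (ENNReal.ofReal_pos.2 hc).ne'
  -- The restricted Lebesgue measure is viewed as a kernel from `Unit`, so that the integral formula
  -- for composed kernels applies.
  have hi' : Integrable g ((extendSlices ρ ∘ₖ Kernel.const Unit (volume.restrict (Ioc s t))) ()) := by
    rw [Kernel.comp_apply, Kernel.const_apply]
    exact (integrable_smul_measure hc0 ENNReal.ofReal_ne_top).1 hi
  have h := Kernel.integral_comp hi'
  rw [Kernel.comp_apply, Kernel.const_apply] at h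
  rw [sliceAverage, integral_smul_measure, h, intervalIntegral.integral_of_le hst,
    ENNReal.toReal_ofReal hc.le]

end SliceAverage

/-! ### Increments of solutions -/

namespace IsTransformerDrift

variable {κ : ℝ} {ℓ m : ℝ → ℝ} {b : ℝ → Seq D N → Seq D N} {H : Seq D N} {X : ℝ → Seq D N}
  {R s t : ℝ}

lemma solution_sub_eq (hb : IsTransformerDrift κ ℓ m b) (hX : IsIntegralSolution b H X)
    (hs : s ∈ Icc (0 : ℝ) 1) (ht : t ∈ Icc (0 : ℝ) 1) :
    X t - X s = ∫ x in s..t, b x (X x) := by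
  have hi := (hb.continuous_comp hX.continuous).intervalIntegrable (μ := volume) 0
  rw [hX.eq_integral t ht, hX.eq_integral s hs, add_sub_add_left_eq_sub,
    intervalIntegral.integral_interval_sub_left (hi t) (hi s)]

lemma norm_solution_increment_le (hb : IsTransformerDrift κ ℓ m b) (hX : IsIntegralSolution b H X)
    (hR : ∀ t ∈ Icc (0 : ℝ) 1, colNorm (X t) ≤ R)
    (hs : s ∈ Icc (0 : ℝ) 1) (ht : t ∈ Icc (0 : ℝ) 1) (hst : s ≤ t) :
    ‖X t - X s‖ ≤ (N + 1) * (κ * R) * ∫ x in s..t, m x := by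
  rw [hb.solution_sub_eq hX hs ht, ← intervalIntegral.integral_const_mul]
  have hm := hb.continuous_mass
  refine intervalIntegral.norm_integral_le_of_norm_le hst
    (Filter.Eventually.of_forall fun x hx => ?_) (Continuous.intervalIntegrable (by fun_prop) _ _)
  have := hb.nonneg_growth
  have := hb.nonneg_mass x
  calc ‖b x (X x)‖ ≤ (N + 1) * colNorm (b x (X x)) := norm_le_colNorm _
    _ ≤ (N + 1) * (κ * m x * R) := by
        refine mul_le_mul_of_nonneg_left ((hb.colNorm_le _ _).trans ?_) (by positivity)
        exact mul_le_mul_of_nonneg_left (hR x ⟨hs.1.trans hx.1.le, hx.2.trans ht.2⟩)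
          (by positivity)
    _ = _ := by ring

/-- The error of one Euler step with the drift frozen at the left end. -/
lemma norm_solution_increment_sub_le (hb : IsTransformerDrift κ ℓ m b)
    (hX : IsIntegralSolution b H X)
    (hR : ∀ t ∈ Icc (0 : ℝ) 1, colNorm (X t) ≤ R)
    (hs : s ∈ Icc (0 : ℝ) 1) (ht : t ∈ Icc (0 : ℝ) 1) (hst : s ≤ t) :
    ‖X t - X s - ∫ x in s..t, b x (X s)‖
      ≤ ℓ ((N + 1) * R) * ((N + 1) * (κ * R)) * (∫ x in s..t, m x) ^ 2 := by
  have hm := hb.continuous_mass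
  have hn : ∀ x ∈ Icc (0 : ℝ) 1, ‖X x‖ ≤ (N + 1) * R := fun x hx =>
    (norm_le_colNorm _).trans (mul_le_mul_of_nonneg_left (hR x hx) (by positivity))
  have hR0 : 0 ≤ R := (colNorm_nonneg _).trans (hR s hs)
  have hκ := hb.nonneg_growth
  rw [hb.solution_sub_eq hX hs ht, ← intervalIntegral.integral_sub
    ((hb.continuous_comp hX.continuous).intervalIntegrable _ _)
    ((hb.continuous_time _).intervalIntegrable _ _)]
  -- The displacement since time s is of the order of the mass of the interval, and the Lipschitz
  -- bound carries another factor m x; integration makes the error quadratic in the mass.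
  have h1 : ∀ x ∈ Ioc s t, ‖b x (X x) - b x (X s)‖
      ≤ ℓ ((N + 1) * R) * ((N + 1) * (κ * R)) * (∫ x in s..t, m x) * m x := fun x hx => by
    have hx' : x ∈ Icc (0 : ℝ) 1 := ⟨hs.1.trans hx.1.le, hx.2.trans ht.2⟩
    refine (hb.lipschitz _ x _ _ (hn x hx') (hn s hs)).trans ?_
    have h2 := hb.norm_solution_increment_le hX hR hs hx' hx.1.le
    have h3 : ∫ y in s..x, m y ≤ ∫ y in s..t, m y :=
      intervalIntegral.integral_mono_interval le_rfl hx.1.le hx.2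
        (Filter.Eventually.of_forall hb.nonneg_mass) (hm.intervalIntegrable _ _)
    have h4 := mul_nonneg (hb.nonneg_lip ((N + 1) * R)) (hb.nonneg_mass x)
    calc _ ≤ ℓ ((N + 1) * R) * m x * ((N + 1) * (κ * R) * ∫ x in s..t, m x) :=
          mul_le_mul_of_nonneg_left (h2.trans (by gcongr)) h4
      _ = _ := by ring
  refine (intervalIntegral.norm_integral_le_of_norm_le hst
    (Filter.Eventually.of_forall h1) (Continuous.intervalIntegrable (by fun_prop) _ _)).trans_eq ?_
  rw [intervalIntegral.integral_const_mul]
  ring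

end IsTransformerDrift

/-! ### Deterministic selection of samples -/

section Sampling

lemma norm_sum_le_of_mem {Ω Y E : Type*} [NormedAddCommGroup E] {S : Set Y} {G : Ω → Y → E} {V : ℝ}
    (hGV : ∀ ω, ∀ β ∈ S, ‖G ω β‖ ≤ V) {n : ℕ} {β : Fin n → Y} (hβ : ∀ j, β j ∈ S) (ω : Ω) :
    ‖∑ j, G ω (β j)‖ ≤ n * V := by
  refine (norm_sum_le_of_le _ fun j _ => hGV ω _ (hβ j)).trans_eq ?_
  simp

lemma stronglyMeasurable_sum_sample {Ω Y E : Type*} [MeasurableSpace Ω] [MeasurableSpace Y]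
    [NormedAddCommGroup E] {G : Ω → Y → E} (hG : StronglyMeasurable (Function.uncurry G)) {n : ℕ}
    (β : Fin n → Y) : StronglyMeasurable fun ω => ∑ j, G ω (β j) :=
  Finset.stronglyMeasurable_fun_sum _ fun _ _ =>
    hG.comp_measurable (measurable_id.prodMk measurable_const)

variable {Ω Y E : Type*} [MeasurableSpace Ω] [MeasurableSpace Y] [NormedAddCommGroup E]
  [InnerProductSpace ℝ E] [CompleteSpace E] {μ : Measure Ω} {ν : Measure Y}
  [IsProbabilityMeasure μ] [IsProbabilityMeasure ν] {S : Set Y} {G : Ω → Y → E} {V : ℝ}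

/-- Samples from a centered bounded random field can be chosen one after the other such that the
mean square of their sum is at most its expectation, jointly with an additive penalty. -/
lemma exists_sample_sq (hG : StronglyMeasurable (Function.uncurry G)) (hS : ν Sᶜ = 0)
    (hGV : ∀ ω, ∀ β ∈ S, ‖G ω β‖ ≤ V) (hG0 : ∀ ω, ∫ β, G ω β ∂ν = 0) {P : Y → ℝ}
    (hP : Integrable P ν) (n : ℕ) :
    ∃ β : Fin n → Y, (∀ j, β j ∈ S) ∧
      ∫ ω, ‖∑ j, G ω (β j)‖ ^ 2 ∂μ + ∑ j, P (β j) ≤ n * (V ^ 2 + ∫ β, P β ∂ν) := by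
  induction n with
  | zero => exact ⟨Fin.elim0, fun j => j.elim0, by simp⟩
  | succ n ih =>
    obtain ⟨β, hβ, hsum⟩ := ih
    set s : Ω → E := fun ω => ∑ j, G ω (β j)
    have hs : StronglyMeasurable s := stronglyMeasurable_sum_sample hG β
    have hsV : ∀ ω, ‖s ω‖ ≤ n * V := norm_sum_le_of_mem hGV hβ
    have hSae : ∀ᵐ y ∂ν, y ∈ S := by rw [ae_iff]; exact hS
    have hF : Integrable (Function.uncurry fun ω y => ‖G ω y + s ω‖ ^ 2) (μ.prod ν) := by
      refine Integrable.of_bound (C := (V + n * V) ^ 2) ?_ ?_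
      · exact ((hG.add (hs.comp_measurable measurable_fst)).norm.pow 2).aestronglyMeasurable
      · filter_upwards [Measure.quasiMeasurePreserving_snd.ae hSae] with z hz
        rw [Function.uncurry, Real.norm_of_nonneg (by positivity)]
        exact pow_le_pow_left₀ (norm_nonneg _)
          ((norm_add_le _ _).trans (add_le_add (hGV _ _ hz) (hsV _))) 2
    have hs2 : Integrable (fun ω => ‖s ω‖ ^ 2) μ := by
      refine Integrable.of_bound (C := (n * V) ^ 2) (hs.norm.pow 2).aestronglyMeasurable
        (Filter.Eventually.of_forall fun ω => ?_)
      rw [Real.norm_of_nonneg (by positivity)]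
      exact pow_le_pow_left₀ (norm_nonneg _) (hsV ω) 2
    -- Centering removes the cross term on average, so one more sample raises the mean square by at
    -- most V².
    have hsq : ∀ ω, ∫ y, ‖G ω y + s ω‖ ^ 2 ∂ν ≤ V ^ 2 + ‖s ω‖ ^ 2 := fun ω => by
      have hm : StronglyMeasurable (G ω) := hG.comp_measurable measurable_prodMk_left
      have hi : Integrable (G ω) ν :=
        Integrable.of_bound hm.aestronglyMeasurable V (hSae.mono (hGV ω))
      have hin : Integrable (fun y => 2 * inner ℝ (G ω y) (s ω)) ν :=
        (hi.inner_const (s ω)).const_mul 2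
      have hn : ∀ᵐ y ∂ν, ‖G ω y‖ ^ 2 ≤ V ^ 2 := hSae.mono fun y hy =>
        pow_le_pow_left₀ (norm_nonneg _) (hGV ω y hy) 2
      have hn2 : Integrable (fun y => ‖G ω y‖ ^ 2) ν :=
        Integrable.of_bound (hm.norm.pow 2).aestronglyMeasurable (V ^ 2)
          (hn.mono fun y hy => by rwa [Real.norm_of_nonneg (by positivity)])
      have h0 : ∫ y, inner ℝ (G ω y) (s ω) ∂ν = 0 := by
        simp_rw [real_inner_comm (s ω)]
        rw [integral_inner hi, hG0, inner_zero_right]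
      simp_rw [norm_add_sq_real]
      rw [integral_add (f := fun y => ‖G ω y‖ ^ 2 + 2 * inner ℝ (G ω y) (s ω)) (hn2.add hin)
        (integrable_const _), integral_add hn2 hin,
        integral_const_mul, h0]
      have := integral_mono_ae hn2 (integrable_const _) hn
      simp only [integral_const, probReal_univ, smul_eq_mul, one_mul] at this ⊢
      linarith
    have hΦ : Integrable (fun y => ∫ ω, ‖G ω y + s ω‖ ^ 2 ∂μ) ν := hF.integral_prod_right
    -- Some point does at least as well as the average of mean square plus penalty, and it can be
    -- found outside the null set `Sᶜ`.
    obtain ⟨y, hy, hle⟩ := exists_notMem_null_le_integral (hΦ.add hP) hS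
    simp only [Pi.add_apply] at hle
    rw [integral_add hΦ hP, ← integral_integral_swap hF] at hle
    have hmean : ∫ ω, ∫ y, ‖G ω y + s ω‖ ^ 2 ∂ν ∂μ ≤ V ^ 2 + ∫ ω, ‖s ω‖ ^ 2 ∂μ := by
      refine (integral_mono hF.integral_prod_left ((integrable_const _).add hs2) hsq).trans_eq ?_
      rw [integral_add' (integrable_const _) hs2]
      simp
    refine ⟨Fin.cons y β, Fin.cases (notMem_compl_iff.1 hy) hβ, ?_⟩
    simp only [Fin.sum_univ_succ, Fin.cons_zero, Fin.cons_succ]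
    push_cast
    change ∫ ω, ‖G ω y + s ω‖ ^ 2 ∂μ + (P y + ∑ j, P (β j)) ≤ _
    change ∫ ω, ‖s ω‖ ^ 2 ∂μ + ∑ j, P (β j) ≤ _ at hsum
    linarith

/-- Samples whose mean deviation is of the order of the inverse square root of their number, and
whose average penalty is controlled at the same time. -/
lemma exists_sample (hG : StronglyMeasurable (Function.uncurry G)) (hS : ν Sᶜ = 0) (hV : 0 < V)
    (hGV : ∀ ω, ∀ β ∈ S, ‖G ω β‖ ≤ V) (hG0 : ∀ ω, ∫ β, G ω β ∂ν = 0) {P : Y → ℝ}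
    (hP : Integrable P ν) {n : ℕ} (hn : 0 < n) (c : ℝ) :
    ∃ β : Fin n → Y, (∀ j, β j ∈ S) ∧
      ∫ ω, ‖(n : ℝ)⁻¹ • ∑ j, G ω (β j)‖ ∂μ + c * ((n : ℝ)⁻¹ * ∑ j, P (β j))
        ≤ V / √n + c * ∫ β, P β ∂ν := by
  have hn' : (0 : ℝ) < n := Nat.cast_pos.2 hn
  -- The mean norm is bounded through 2 w x ≤ x² + w² instead of a square root, because this keeps
  -- the penalty additive. The choice w² = n V² balances the two terms, and the weight 2 w c below
  -- becomes c after division by 2 w.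
  set w : ℝ := √n * V
  have hw : 0 < w := mul_pos (Real.sqrt_pos.2 hn') hV
  have hw2 : w ^ 2 = n * V ^ 2 := by rw [mul_pow, Real.sq_sqrt hn'.le]
  obtain ⟨β, hβ, h⟩ := exists_sample_sq (μ := μ) hG hS hGV hG0 (hP.const_mul (2 * w * c)) n
  refine ⟨β, hβ, ?_⟩
  have hs := stronglyMeasurable_sum_sample hG β
  have hsV := norm_sum_le_of_mem hGV hβ
  have hs2 : Integrable (fun ω => ‖∑ j, G ω (β j)‖ ^ 2) μ := by
    refine Integrable.of_bound (C := (n * V) ^ 2) (hs.norm.pow 2).aestronglyMeasurable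
      (Filter.Eventually.of_forall fun ω => ?_)
    rw [Real.norm_of_nonneg (by positivity)]
    exact pow_le_pow_left₀ (norm_nonneg _) (hsV ω) 2
  have hs1 : Integrable (fun ω => ‖∑ j, G ω (β j)‖) μ :=
    Integrable.of_bound (C := n * V) hs.norm.aestronglyMeasurable
      (Filter.Eventually.of_forall fun ω => by rw [norm_norm]; exact hsV ω)
  have h1 : 2 * w * ∫ ω, ‖∑ j, G ω (β j)‖ ∂μ ≤ ∫ ω, ‖∑ j, G ω (β j)‖ ^ 2 ∂μ + w ^ 2 := by
    rw [← integral_const_mul]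
    refine (integral_mono (hs1.const_mul (2 * w)) (hs2.add (integrable_const (w ^ 2)))
      fun ω => ?_).trans_eq ?_
    · simp only [Pi.add_apply]
      nlinarith [sq_nonneg (‖∑ j, G ω (β j)‖ - w)]
    · rw [integral_add' hs2 (integrable_const _)]
      simp
  rw [← Finset.mul_sum, integral_const_mul] at h
  have h2 : ∫ ω, ‖∑ j, G ω (β j)‖ ∂μ + c * ∑ j, P (β j) ≤ w + n * (c * ∫ β, P β ∂ν) := by
    refine le_of_mul_le_mul_left (a := 2 * w) ?_ (by positivity)
    nlinarith
  simp only [norm_smul, norm_inv, Real.norm_natCast]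
  rw [integral_const_mul]
  have h3 : V / √n = (n : ℝ)⁻¹ * w := by
    have := Real.sqrt_pos.2 hn'
    have := Real.mul_self_sqrt hn'.le
    field_simp
    nlinarith
  have h4 := mul_le_mul_of_nonneg_left h2 (inv_pos.2 hn').le
  rw [h3]
  have h5 : (n : ℝ)⁻¹ * n = 1 := inv_mul_cancel₀ hn'.ne'
  linear_combination h4 + (c * ∫ β, P β ∂ν) * h5

end Sampling

/-! ### Sampling particles for the drift. -/

section DriftSampling

variable {K r R : ℝ} {φP φT : ℝ → ℝ} {f : Seq D N → Vec p → Seq D N}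
  {h : Seq D N → Vec q → Seq D N} {Ω : Type*} [MeasurableSpace Ω]

/-- The deviation of the average drift of `M` particles at `Z` from the mean drift under `ν`. -/
def samplingError {M : ℕ} (f : Seq D N → Vec p → Seq D N) (h : Seq D N → Vec q → Seq D N)
    (ν : Measure (Particle p q)) (β : Fin M → Particle p q) (Z : Seq D N) : Seq D N :=
  (M : ℝ)⁻¹ • ∑ j, drift f h Z (β j) - ∫ β', drift f h Z β' ∂ν

lemma stronglyMeasurable_drift (hf : ParticleGrowth K φP φT f) (hh : ParticleGrowth K φP φT h) :
    StronglyMeasurable (Function.uncurry (drift f h)) :=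
  stronglyMeasurable_uncurry_of_continuous_of_stronglyMeasurable
    (continuous_drift_input hf hh) fun Z => (continuous_drift_particle hf hh Z).stronglyMeasurable

lemma stronglyMeasurable_integral_drift (hf : ParticleGrowth K φP φT f)
    (hh : ParticleGrowth K φP φT h) (ν : Measure (Particle p q)) [SFinite ν] :
    StronglyMeasurable fun Z => ∫ β, drift f h Z β ∂ν :=
  (stronglyMeasurable_drift hf hh).integral_prod_right

lemma stronglyMeasurable_samplingError (hf : ParticleGrowth K φP φT f)
    (hh : ParticleGrowth K φP φT h) (ν : Measure (Particle p q)) [SFinite ν] {M : ℕ}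
    (β : Fin M → Particle p q) : StronglyMeasurable (samplingError f h ν β) := by
  change StronglyMeasurable
    fun Z => (M : ℝ)⁻¹ • ∑ j, drift f h Z (β j) - ∫ β', drift f h Z β' ∂ν
  have hs : StronglyMeasurable fun Z => ∑ j, drift f h Z (β j) :=
    Finset.stronglyMeasurable_fun_sum _ fun j _ =>
      (continuous_drift_input hf hh (β j)).stronglyMeasurable
  exact (hs.const_smul (M : ℝ)⁻¹).sub (stronglyMeasurable_integral_drift hf hh ν)

lemma norm_drift_le (hf : ParticleGrowth K φP φT f) (hh : ParticleGrowth K φP φT h)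
    (hK : 0 < K) (hr : 0 < r) {Z : Seq D N} (hZ : colNorm Z ≤ R) {β : Particle p q}
    (hβ : β ∈ Metric.closedBall 0 r) :
    ‖drift f h Z β‖ ≤ (N + 1) * (growthRate K r * R) :=
  (norm_le_colNorm _).trans <| mul_le_mul_of_nonneg_left
    ((colNorm_drift_le hf hh hK Z hβ).trans
      (mul_le_mul_of_nonneg_left hZ (growthRate_nonneg hK hr))) (by positivity)

lemma norm_integral_drift_le (hf : ParticleGrowth K φP φT f) (hh : ParticleGrowth K φP φT h)
    (hK : 0 < K) (hr : 0 < r) {ν : Measure (Particle p q)} [IsProbabilityMeasure ν]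
    (hν : ν (Metric.closedBall 0 r)ᶜ = 0) {Z : Seq D N} (hZ : colNorm Z ≤ R) :
    ‖∫ β, drift f h Z β ∂ν‖ ≤ (N + 1) * (growthRate K r * R) := by
  simpa using norm_integral_le_of_closedBall hν fun β hβ => norm_drift_le hf hh hK hr hZ hβ

lemma norm_samplingError_le (hf : ParticleGrowth K φP φT f) (hh : ParticleGrowth K φP φT h)
    (hK : 0 < K) (hr : 0 < r) {ν : Measure (Particle p q)} [IsProbabilityMeasure ν]
    (hν : ν (Metric.closedBall 0 r)ᶜ = 0) {Z : Seq D N} (hZ : colNorm Z ≤ R) {M : ℕ} (hM : 0 < M)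
    {β : Fin M → Particle p q} (hβ : ∀ j, β j ∈ Metric.closedBall 0 r) :
    ‖samplingError f h ν β Z‖ ≤ 2 * ((N + 1) * (growthRate K r * R)) := by
  have hM' : (0 : ℝ) < M := Nat.cast_pos.2 hM
  have h1 : ‖(M : ℝ)⁻¹ • ∑ j, drift f h Z (β j)‖ ≤ (N + 1) * (growthRate K r * R) := by
    rw [norm_smul, norm_inv, Real.norm_natCast, inv_mul_le_iff₀ hM']
    refine (norm_sum_le_of_le _ fun j _ => norm_drift_le hf hh hK hr hZ (hβ j)).trans_eq ?_
    simp
  have h2 := norm_integral_drift_le hf hh hK hr hν hZ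
  exact (norm_sub_le _ _).trans (by linarith)

lemma exists_drift_sample (hf : ParticleGrowth K φP φT f) (hh : ParticleGrowth K φP φT h)
    (hK : 0 < K) (hr : 0 < r) {μ : Measure Ω} [IsProbabilityMeasure μ]
    {ν : Measure (Particle p q)} [IsProbabilityMeasure ν]
    (hν : ν (Metric.closedBall 0 r)ᶜ = 0) {Z : Ω → Seq D N} (hZm : StronglyMeasurable Z)
    (hZ : ∀ ω, colNorm (Z ω) ≤ R) {M : ℕ} (hM : 0 < M) (c : ℝ) :
    ∃ β : Fin M → Particle p q, (∀ j, β j ∈ Metric.closedBall 0 r) ∧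
      ∫ ω, ‖samplingError f h ν β (Z ω)‖ ∂μ + c * ((M : ℝ)⁻¹ * ∑ j, ‖β j‖ ^ 2)
        ≤ (2 * ((N + 1) * (growthRate K r * R)) + 1) / √M + c * ∫ β, ‖β‖ ^ 2 ∂ν := by
  have hM' : (M : ℝ) ≠ 0 := Nat.cast_ne_zero.2 hM.ne'
  obtain ⟨ω₀⟩ : Nonempty Ω := μ.nonempty_of_neZero
  have hR : 0 ≤ R := (colNorm_nonneg _).trans (hZ ω₀)
  have hg := growthRate_nonneg hK hr
  have hi : ∀ ω, Integrable (drift f h (Z ω)) ν := fun ω =>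
    integrable_of_closedBall hν (continuous_drift_particle hf hh _)
  obtain ⟨β, hβ, hle⟩ := exists_sample (μ := μ) (ν := ν) (S := Metric.closedBall 0 r)
    (G := fun ω β => drift f h (Z ω) β - ∫ β', drift f h (Z ω) β' ∂ν)
    -- The drift and its mean each contribute one copy of the bound; the summand 1 makes V positive
    -- even when R = 0.
    (V := 2 * ((N + 1) * (growthRate K r * R)) + 1) (P := fun β => ‖β‖ ^ 2) (n := M)
    (((stronglyMeasurable_drift hf hh).comp_measurable
        ((hZm.measurable.comp measurable_fst).prodMk measurable_snd)).sub
      ((stronglyMeasurable_integral_drift hf hh ν).comp_measurable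
        (hZm.measurable.comp measurable_fst)))
    hν (by positivity)
    (fun ω β hβ => by
      have h1 := norm_drift_le hf hh hK hr (hZ ω) hβ
      have h2 := norm_integral_drift_le hf hh hK hr hν (hZ ω)
      exact (norm_sub_le _ _).trans (by linarith))
    (fun ω => by
      rw [integral_sub (hi ω) (integrable_const _), integral_const]
      simp)
    (integrable_of_closedBall hν (by fun_prop)) hM c
  refine ⟨β, hβ, ?_⟩
  have e : ∀ ω, (M : ℝ)⁻¹ • ∑ j, (drift f h (Z ω) (β j) - ∫ β', drift f h (Z ω) β' ∂ν)
      = samplingError f h ν β (Z ω) := fun ω => by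
    rw [Finset.sum_sub_distrib, smul_sub, samplingError]
    congr 1
    rw [Finset.sum_const, Finset.card_univ, Fintype.card_fin, ← Nat.cast_smul_eq_nsmul ℝ,
      smul_smul, inv_mul_cancel₀ hM', one_smul]
  simpa only [e] using hle

end DriftSampling

/-! ### The discrete Transformer -/

lemma norm_inv_smul_sum_le {E : Type*} [NormedAddCommGroup E] [NormedSpace ℝ E] {M : ℕ}
    (hM : 0 < M) {x : Fin M → E} {c : ℝ} (hx : ∀ j, ‖x j‖ ≤ c) :
    ‖(M : ℝ)⁻¹ • ∑ j, x j‖ ≤ c := by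
  rw [norm_smul, norm_inv, Real.norm_natCast, inv_mul_le_iff₀ (Nat.cast_pos.2 hM)]
  refine (norm_sum_le_of_le _ fun j _ => hx j).trans_eq ?_
  simp

lemma colNorm_inv_smul_sum_le {M : ℕ} (hM : 0 < M) {x : Fin M → Seq D N} {c : ℝ}
    (hx : ∀ j, colNorm (x j) ≤ c) : colNorm ((M : ℝ)⁻¹ • ∑ j, x j) ≤ c :=
  colNorm_le_of_forall fun i => by
    rw [← colL_apply, map_smul, map_sum]
    exact norm_inv_smul_sum_le hM fun j => (norm_col_le_colNorm _ i).trans (hx j)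

/-- The discrete Grönwall inequality. -/
lemma le_exp_mul_sum_of_succ_le {a : ℝ} (ha : 0 ≤ a) {L : ℕ} {F : Fin (L + 1) → ℝ}
    {d : Fin L → ℝ} (hd : ∀ k, 0 ≤ d k) (h0 : F 0 ≤ 0)
    (h : ∀ k, F (Fin.succ k) ≤ (1 + a) * F (Fin.castSucc k) + d k) :
    F (Fin.last L) ≤ Real.exp (a * L) * ∑ k, d k := by
  induction L with
  | zero => simpa using h0
  | succ L ih =>
    have h1 := ih (F := fun k => F k.castSucc) (d := fun k => d k.castSucc)
      (fun k => hd _) h0 (fun k => h k.castSucc)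
    have h2 := h (Fin.last L)
    rw [Fin.succ_last] at h2
    rw [Fin.sum_univ_castSucc]
    set S := ∑ k : Fin L, d k.castSucc
    have hS : 0 ≤ S := Finset.sum_nonneg fun k _ => hd _
    have h3 : (1 + a) * (Real.exp (a * L) * S) ≤ Real.exp (a * (L + 1 : ℕ)) * S := by
      push_cast
      rw [mul_add, mul_one, Real.exp_add, ← mul_assoc, mul_comm (1 + a)]
      have := Real.add_one_le_exp a
      have := Real.exp_pos (a * L)
      gcongr
      linarith
    have h4 : d (Fin.last L) ≤ Real.exp (a * (L + 1 : ℕ)) * d (Fin.last L) :=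
      le_mul_of_one_le_left (hd _) (Real.one_le_exp (by positivity))
    have h5 := mul_le_mul_of_nonneg_left h1 (by linarith : 0 ≤ 1 + a)
    change (1 + a) * F (Fin.last L).castSucc ≤ _ at h5
    change F (Fin.last (L + 1)) ≤ _ at h2
    rw [mul_add]
    linarith

lemma discreteState_zero {L M : ℕ} (f : Seq D N → Vec p → Seq D N) (h : Seq D N → Vec q → Seq D N)
    (Θ : Params p q L M) (H : Seq D N) : discreteState f h Θ H 0 = H :=
  rfl

lemma discreteState_succ {L M : ℕ} (f : Seq D N → Vec p → Seq D N) (h : Seq D N → Vec q → Seq D N)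
    (Θ : Params p q L M) (H : Seq D N) (k : Fin L) :
    discreteState f h Θ H k.succ
      = block f h (Θ k) (1 / (L : ℝ) / 2) (discreteState f h Θ H k.castSucc) :=
  Fin.induction_succ (motive := fun _ => Seq D N) _ _ k

section Discrete

variable {K r R η : ℝ} {φP φT : ℝ → ℝ} {f : Seq D N → Vec p → Seq D N}
  {h : Seq D N → Vec q → Seq D N} {M : ℕ}

lemma colNorm_residualLayer_le (hf : ParticleGrowth K φP φT f) (hK : 0 < K) (hM : 0 < M)
    (hη : 0 ≤ η) {α : Fin M → Vec p} (hα : ∀ j, ‖α j‖ ≤ r) (Z : Seq D N) :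
    colNorm (residualLayer f α Z η) ≤ (1 + η * growthRate K r) * colNorm Z := by
  have h1 : colNorm ((M : ℝ)⁻¹ • ∑ j, f Z (α j)) ≤ growthRate K r * colNorm Z :=
    colNorm_inv_smul_sum_le hM fun j => hf.colNorm_le_growthRate hK Z (hα j)
  have h2 := colNorm_smul_le η ((M : ℝ)⁻¹ • ∑ j, f Z (α j))
  rw [abs_of_nonneg hη] at h2
  have h3 := mul_le_mul_of_nonneg_left h1 hη
  have h4 := colNorm_add_le Z (η • ((M : ℝ)⁻¹ • ∑ j, f Z (α j)))
  unfold residualLayer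
  linarith

variable {β : Fin M → Particle p q}

/-- The intermediate state is given the factor of the whole block, so that both states obey the
bound for the end of the block. -/
lemma colNorm_block_le (hf : ParticleGrowth K φP φT f) (hh : ParticleGrowth K φP φT h)
    (hK : 0 < K) (hr : 0 < r) (hM : 0 < M) (hη : 0 ≤ η)
    (hβ : ∀ j, β j ∈ Metric.closedBall 0 r) (Z : Seq D N) :
    colNorm (residualLayer f (fun j => (β j).fst) Z η)
        ≤ Real.exp (2 * η * growthRate K r) * colNorm Z ∧
      colNorm (block f h β η Z) ≤ Real.exp (2 * η * growthRate K r) * colNorm Z := by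
  simp only [mem_closedBall_zero_iff] at hβ
  have hκ := growthRate_nonneg hK hr
  have h1 := colNorm_residualLayer_le hf hK hM hη
    (fun j => (norm_fst_le_norm (β j)).trans (hβ j)) Z
  have h2 := colNorm_residualLayer_le hh hK hM hη
    (fun j => (norm_snd_le_norm (β j)).trans (hβ j)) (residualLayer f (fun j => (β j).fst) Z η)
  have h3 : 1 + η * growthRate K r ≤ Real.exp (η * growthRate K r) := by
    linarith [Real.add_one_le_exp (η * growthRate K r)]
  have h4 : Real.exp (η * growthRate K r) * Real.exp (η * growthRate K r)
      = Real.exp (2 * η * growthRate K r) := by rw [← Real.exp_add]; ring_nf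
  have hZ := colNorm_nonneg Z
  have h5 : 0 ≤ 1 + η * growthRate K r := by positivity
  rw [← h4]
  constructor
  · refine h1.trans (mul_le_mul_of_nonneg_right (h3.trans ?_) hZ)
    exact le_mul_of_one_le_left (Real.exp_pos _).le (Real.one_le_exp (by positivity))
  · refine h2.trans ((mul_le_mul_of_nonneg_left h1 h5).trans ?_)
    rw [← mul_assoc]
    gcongr

lemma colNorm_discreteState_le (hf : ParticleGrowth K φP φT f) (hh : ParticleGrowth K φP φT h)
    (hK : 0 < K) (hr : 0 < r) (hM : 0 < M) {L : ℕ} {Θ : Params p q L M}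
    (hΘ : ∀ k j, Θ k j ∈ Metric.closedBall 0 r) (H : Seq D N) (k : Fin (L + 1)) :
    colNorm (discreteState f h Θ H k) ≤ Real.exp (k * (1 / L) * growthRate K r) * colNorm H := by
  induction k using Fin.induction with
  | zero => simp [discreteState_zero]
  | succ k ih =>
    rw [discreteState_succ]
    refine (colNorm_block_le hf hh hK hr hM (by positivity) (hΘ k) _).2.trans ?_
    refine (mul_le_mul_of_nonneg_left ih (Real.exp_pos _).le).trans_eq ?_
    rw [← mul_assoc, ← Real.exp_add]
    congr 2
    simp only [Fin.val_castSucc, Fin.val_succ]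
    push_cast
    ring

/-- A block is an explicit step along the mean drift, up to an error of second order. -/
lemma norm_block_sub_le (hf : ParticleGrowth K φP φT f) (hh : ParticleGrowth K φP φT h)
    (hφT : IsGrowthFunction φT) (hK : 0 < K) (hr : 0 < r) (hM : 0 < M) (hη : 0 ≤ η)
    (hβ : ∀ j, β j ∈ Metric.closedBall 0 r) {Z : Seq D N} (hZ : colNorm Z ≤ R)
    (hZ' : colNorm (residualLayer f (fun j => (β j).fst) Z η) ≤ R) :
    ‖block f h β η Z - Z - (2 * η) • ((M : ℝ)⁻¹ • ∑ j, drift f h Z (β j))‖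
      ≤ lipConst φT r ((N + 1) * R) * ((N + 1) * (growthRate K r * R)) * η ^ 2 := by
  simp only [mem_closedBall_zero_iff] at hβ
  have hκ := growthRate_nonneg hK hr
  set Y := residualLayer f (fun j => (β j).fst) Z η with hY
  set ℓ := lipConst φT r ((N + 1) * R)
  have hℓ : 0 ≤ ℓ := lipConst_nonneg φT hr _
  have hn : ∀ {Z : Seq D N}, colNorm Z ≤ R → ‖Z‖ ≤ (N + 1) * R := fun hZ =>
    (norm_le_colNorm _).trans (mul_le_mul_of_nonneg_left hZ (by positivity))
  -- The block differs from the explicit step only in that `h` is evaluated at the intermediate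
  -- state `Y`, which is O(η) away from `Z`.
  have e : block f h β η Z - Z - (2 * η) • ((M : ℝ)⁻¹ • ∑ j, drift f h Z (β j))
      = η • ((M : ℝ)⁻¹ • ∑ j, (h Y (β j).snd - h Z (β j).snd)) := by
    have h1 : block f h β η Z = Y + η • ((M : ℝ)⁻¹ • ∑ j, h Y (β j).snd) := rfl
    have h2 : Y = Z + η • ((M : ℝ)⁻¹ • ∑ j, f Z (β j).fst) := rfl
    have h3 : ∑ j, drift f h Z (β j)
        = (1 / 2 : ℝ) • (∑ j, f Z (β j).fst + ∑ j, h Z (β j).snd) := by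
      simp only [drift, ← Finset.smul_sum, Finset.sum_add_distrib]
    rw [h1, h3, Finset.sum_sub_distrib]
    nth_rewrite 1 [h2]
    module
  have hYZ : ‖Y - Z‖ ≤ η * ((N + 1) * (growthRate K r * R)) := by
    rw [hY, residualLayer, add_sub_cancel_left, norm_smul, Real.norm_of_nonneg hη]
    refine mul_le_mul_of_nonneg_left (norm_inv_smul_sum_le hM fun j => ?_) hη
    refine (norm_le_colNorm _).trans (mul_le_mul_of_nonneg_left ?_ (by positivity))
    exact (hf.colNorm_le_growthRate hK Z ((norm_fst_le_norm (β j)).trans (hβ j))).trans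
      (mul_le_mul_of_nonneg_left hZ hκ)
  rw [e, norm_smul, Real.norm_of_nonneg hη]
  calc η * ‖(M : ℝ)⁻¹ • ∑ j, (h Y (β j).snd - h Z (β j).snd)‖
      ≤ η * (ℓ * (η * ((N + 1) * (growthRate K r * R)))) := by
        refine mul_le_mul_of_nonneg_left (norm_inv_smul_sum_le hM fun j => ?_) hη
        exact (hh.norm_sub_le hφT ((norm_snd_le_norm (β j)).trans (hβ j)) (hn hZ') (hn hZ)).trans
          (mul_le_mul_of_nonneg_left hYZ hℓ)
    _ = _ := by ring

end Discrete

/-! ### Distance between the discrete Transformer and the flow. -/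

section Comparison

variable {K r B : ℝ} {φP φT : ℝ → ℝ} {f : Seq D N → Vec p → Seq D N}
  {h : Seq D N → Vec q → Seq D N} {ρ : Kernel unitInterval (Particle p q)} {L M : ℕ}

lemma colNorm_extendFlow_le (hf : ParticleGrowth K φP φT f) (hh : ParticleGrowth K φP φT h)
    (hφT : IsGrowthFunction φT) (hK : 0 < K) (hr : 0 < r) (hρ : ρ ∈ P2 p q r) {H : Seq D N}
    (hH : colNorm H ≤ B) {t : ℝ} (ht : t ∈ Icc (0 : ℝ) 1) :
    colNorm (extendFlow f h ρ H t) ≤ B * Real.exp (growthRate K r) :=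
  ((isTransformerDrift_field hf hh hφT hK hr hρ).colNorm_solution_le
    (isIntegralSolution_extendFlow hf hh hφT hK hr hρ H) ht).trans
    (mul_le_mul_of_nonneg_right hH (Real.exp_pos _).le)

lemma colNorm_discreteState_le_of_le (hf : ParticleGrowth K φP φT f)
    (hh : ParticleGrowth K φP φT h) (hK : 0 < K) (hr : 0 < r) (hM : 0 < M) (hL : 0 < L)
    {Θ : Params p q L M} (hΘ : ∀ k j, Θ k j ∈ Metric.closedBall 0 r) {H : Seq D N}
    (hH : colNorm H ≤ B) (k : Fin (L + 1)) :
    colNorm (discreteState f h Θ H k) ≤ B * Real.exp (growthRate K r) := by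
  have hκ := growthRate_nonneg hK hr
  have hL' : (0 : ℝ) < L := Nat.cast_pos.2 hL
  refine (colNorm_discreteState_le hf hh hK hr hM hΘ H k).trans ?_
  rw [mul_comm B]
  have hk : (k : ℝ) * (1 / L) ≤ 1 := by
    rw [mul_one_div, div_le_one hL']
    exact_mod_cast Nat.lt_succ_iff.1 k.2
  gcongr
  · exact colNorm_nonneg H
  · exact mul_le_of_le_one_left hκ hk

/-- The distance of the discrete Transformer to the flow is controlled by the sampling errors of the
layers along the flow. -/
lemma norm_discreteState_sub_extendFlow_le (hf : ParticleGrowth K φP φT f)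
    (hh : ParticleGrowth K φP φT h)
    (hφT : IsGrowthFunction φT) (hK : 0 < K) (hr : 0 < r) (hρ : ρ ∈ P2 p q r)
    (hL : 0 < L) (hM : 0 < M) {τ : ℕ → ℝ} (hτ0 : τ 0 = 0) (hτL : τ L = 1)
    (hτ : ∀ k ≤ L, τ k ∈ Icc (0 : ℝ) 1)
    (hτs : ∀ k < L, τ k ≤ τ (k + 1) ∧ ∫ t in τ k..τ (k + 1), sliceMass ρ t = (L : ℝ)⁻¹)
    {Θ : Params p q L M} (hΘ : ∀ k j, Θ k j ∈ Metric.closedBall 0 r)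
    {H : Seq D N} (hH : colNorm H ≤ B) {R ℓ V : ℝ} (hR : R = B * Real.exp (growthRate K r))
    (hℓ : ℓ = lipConst φT r ((N + 1) * R)) (hV : V = (N + 1) * (growthRate K r * R)) :
    ‖discreteState f h Θ H (Fin.last L) - extendFlow f h ρ H 1‖
      ≤ Real.exp ℓ * ((L : ℝ)⁻¹ * ∑ k : Fin L, ‖samplingError f h
          (sliceAverage ρ L (τ k) (τ (k + 1))) (Θ k) (extendFlow f h ρ H (τ k))‖
        + 2 * (ℓ * V) * (L : ℝ)⁻¹) := by
  have hκ := growthRate_nonneg hK hr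
  have hL' : (0 : ℝ) < L := Nat.cast_pos.2 hL
  have hR0 : 0 ≤ R := by
    have := (colNorm_nonneg H).trans hH
    rw [hR]; positivity
  have hV0 : 0 ≤ V := by rw [hV]; positivity
  have hℓ0 : 0 ≤ ℓ := by rw [hℓ]; exact lipConst_nonneg φT hr _
  have hb := isTransformerDrift_field hf hh hφT hK hr hρ
  set X := extendFlow f h ρ H
  have hX : IsIntegralSolution (field f h ρ) H X :=
    isIntegralSolution_extendFlow hf hh hφT hK hr hρ H
  have hXR : ∀ t ∈ Icc (0 : ℝ) 1, colNorm (X t) ≤ R := fun t ht =>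
    hR ▸ colNorm_extendFlow_le hf hh hφT hK hr hρ hH ht
  have hn : ∀ {Z : Seq D N}, colNorm Z ≤ R → ‖Z‖ ≤ (N + 1) * R := fun hZ =>
    (norm_le_colNorm _).trans (mul_le_mul_of_nonneg_left hZ (by positivity))
  set ξ : Fin L → ℝ := fun k => ‖samplingError f h
    (sliceAverage ρ L (τ k) (τ (k + 1))) (Θ k) (X (τ k))‖
  have hG := le_exp_mul_sum_of_succ_le (a := ℓ / L) (by positivity)
    (F := fun k => ‖discreteState f h Θ H k - X (τ k)‖)
    -- One ℓ V / L² pays for the block and one for the Euler step of the flow; L layers sum to 2 ℓ V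
    -- / L.
    (d := fun k => (L : ℝ)⁻¹ * ξ k + 2 * (ℓ * V) * (L : ℝ)⁻¹ ^ 2)
    (fun k => by positivity)
    (by simp [discreteState_zero, hτ0, hX.eq_integral 0 (left_mem_Icc.2 zero_le_one)])
    (fun k => ?_)
  · simp only [Fin.val_last, hτL] at hG
    refine hG.trans_eq ?_
    rw [div_mul_cancel₀ _ hL'.ne', Finset.sum_add_distrib, ← Finset.mul_sum, Finset.sum_const,
      Finset.card_univ, Fintype.card_fin, nsmul_eq_mul]
    field_simp
  · obtain ⟨hle, hmass⟩ := hτs k k.2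
    have hk0 := hτ k k.2.le
    have hk1 := hτ (k + 1) k.2
    simp only [discreteState_succ, Fin.val_castSucc, Fin.val_succ]
    set Z := discreteState f h Θ H k.castSucc
    have hZ : colNorm Z ≤ R :=
      hR ▸ colNorm_discreteState_le_of_le hf hh hK hr hM hL hΘ hH k.castSucc
    have hZ' : colNorm (residualLayer f (fun j => (Θ k j).fst) Z (1 / L / 2)) ≤ R := by
      refine (colNorm_block_le (h := h) hf hh hK hr hM (by positivity) (hΘ k) Z).1.trans ?_
      refine (mul_le_mul_of_nonneg_left (colNorm_discreteState_le hf hh hK hr hM hΘ H k.castSucc)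
        (Real.exp_pos _).le).trans ?_
      rw [← mul_assoc, ← Real.exp_add, hR, mul_comm B]
      have hk : (k : ℝ) + 1 ≤ L := by exact_mod_cast k.2
      gcongr
      · exact colNorm_nonneg H
      · have : 2 * (1 / (L : ℝ) / 2) * growthRate K r
            + ((k.castSucc : ℕ) : ℝ) * (1 / L) * growthRate K r
            = ((k + 1) / L) * growthRate K r := by
          rw [Fin.val_castSucc]; ring
        rw [this]
        exact mul_le_of_le_one_left hκ ((div_le_one hL').2 hk)
    have h1 := norm_block_sub_le hf hh hφT hK hr hM (η := 1 / (L : ℝ) / 2) (by positivity)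
      (hΘ k) hZ hZ'
    rw [← hℓ, ← hV] at h1
    have h2 := hb.norm_solution_increment_sub_le hX hXR hk0 hk1 hle
    rw [← hℓ, ← hV, hmass] at h2
    have h3 : ‖(M : ℝ)⁻¹ • ∑ j, (drift f h Z (Θ k j) - drift f h (X (τ k)) (Θ k j))‖
        ≤ ℓ * ‖Z - X (τ k)‖ :=
      norm_inv_smul_sum_le hM fun j =>
        hℓ ▸ norm_drift_sub_le hf hh hφT (hΘ k j) (hn hZ) (hn (hXR _ hk0))
    have h4 : ∫ x in τ k..τ (k + 1), field f h ρ x (X (τ k)) = (L : ℝ)⁻¹ •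
        ∫ β, drift f h (X (τ k)) β ∂(sliceAverage ρ L (τ k) (τ (k + 1))) := by
      rw [integral_sliceAverage hr hρ hL' hle hmass (continuous_drift_particle hf hh _), smul_smul,
        inv_mul_cancel₀ hL'.ne', one_smul]
      rfl
    rw [h4] at h2
    set Z₁ := block f h (Θ k) (1 / L / 2) Z
    set I := ∫ β, drift f h (X (τ k)) β ∂(sliceAverage ρ L (τ k) (τ (k + 1)))
    -- The five terms are the previous error, the block error, the stability error of the same
    -- particles at two states, the sampling error at the state of the flow, and the Euler error of
    -- the flow.
    have e : Z₁ - X (τ (k + 1)) = (Z - X (τ k))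
        + (Z₁ - Z - (2 * (1 / (L : ℝ) / 2)) • ((M : ℝ)⁻¹ • ∑ j, drift f h Z (Θ k j)))
        + (L : ℝ)⁻¹ • ((M : ℝ)⁻¹ • ∑ j, (drift f h Z (Θ k j) - drift f h (X (τ k)) (Θ k j)))
        + (L : ℝ)⁻¹ • samplingError f h
          (sliceAverage ρ L (τ k) (τ (k + 1))) (Θ k) (X (τ k))
        - (X (τ (k + 1)) - X (τ k) - (L : ℝ)⁻¹ • I) := by
      have : 2 * (1 / (L : ℝ) / 2) = (L : ℝ)⁻¹ := by ring
      rw [this, Finset.sum_sub_distrib, samplingError]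
      module
    have h5 : ‖(L : ℝ)⁻¹ • ((M : ℝ)⁻¹ •
        ∑ j, (drift f h Z (Θ k j) - drift f h (X (τ k)) (Θ k j)))‖
        ≤ (L : ℝ)⁻¹ * (ℓ * ‖Z - X (τ k)‖) := by
      rw [norm_smul, norm_inv, Real.norm_natCast]
      gcongr
    have h6 : ‖(L : ℝ)⁻¹ • samplingError f h
        (sliceAverage ρ L (τ k) (τ (k + 1))) (Θ k) (X (τ k))‖ = (L : ℝ)⁻¹ * ξ k := by
      rw [norm_smul, norm_inv, Real.norm_natCast]
    have h7 : ℓ * V * (1 / (L : ℝ) / 2) ^ 2 ≤ ℓ * V * (L : ℝ)⁻¹ ^ 2 := by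
      have : 1 / (L : ℝ) / 2 ≤ (L : ℝ)⁻¹ := by
        rw [one_div]; linarith [inv_pos.2 hL']
      gcongr
    rw [e]
    refine (norm_sub_le _ _).trans ?_
    refine (add_le_add_left (norm_add₄_le ..) _).trans ?_
    rw [h6]
    have h8 : ℓ / L * ‖Z - X (τ k)‖ = (L : ℝ)⁻¹ * (ℓ * ‖Z - X (τ k)‖) := by ring
    linarith

end Comparison

/-! ### Comparison of the risks -/

section Risk

variable {K r B Ky : ℝ} {φP φT : ℝ → ℝ} {f : Seq D N → Vec p → Seq D N}
  {h : Seq D N → Vec q → Seq D N} {ρ : Kernel unitInterval (Particle p q)}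
  {μ : Measure (Seq D N)} {y : Seq D N → ℝ}

/-- This serves only to make the flow measurable in the initial value on the support of the data. -/
lemma continuousOn_extendFlow (hf : ParticleGrowth K φP φT f) (hh : ParticleGrowth K φP φT h)
    (hφT : IsGrowthFunction φT) (hK : 0 < K) (hr : 0 < r) (hρ : ρ ∈ P2 p q r) {t : ℝ}
    (ht : t ∈ Icc (0 : ℝ) 1) :
    ContinuousOn (fun H => extendFlow f h ρ H t) {H | colNorm H ≤ B} := by
  have hb := isTransformerDrift_field hf hh hφT hK hr hρ
  set R := (N + 1) * (B * Real.exp (growthRate K r))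
  have hR : ∀ H ∈ {H : Seq D N | colNorm H ≤ B}, ∀ t ∈ Icc (0 : ℝ) 1,
      ‖extendFlow f h ρ H t‖ ≤ R := fun H hH t ht =>
    (norm_le_colNorm _).trans (mul_le_mul_of_nonneg_left
      (colNorm_extendFlow_le hf hh hφT hK hr hρ hH ht) (by positivity))
  refine LipschitzOnWith.continuousOn (K := (Real.exp (lipConst φT r R)).toNNReal)
    (LipschitzOnWith.of_dist_le_mul fun H hH H' hH' => ?_)
  rw [Real.coe_toNNReal _ (Real.exp_pos _).le, dist_eq_norm, dist_eq_norm, mul_comm]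
  exact hb.norm_solution_sub_le (isIntegralSolution_extendFlow hf hh hφT hK hr hρ H)
    (isIntegralSolution_extendFlow hf hh hφT hK hr hρ H') (hR H hH) (hR H' hH') ht

lemma DataRegularity.continuousOn_label (hD : DataRegularity B Ky μ y) (hKy : 0 < Ky) :
    ContinuousOn y μ.support := by
  refine LipschitzOnWith.continuousOn (K := Ky.toNNReal)
    (LipschitzOnWith.of_dist_le_mul fun H hH H' hH' => ?_)
  rw [Real.coe_toNNReal _ hKy.le, dist_eq_norm, dist_eq_norm]
  exact hD.label_lipschitz H hH H' hH'

/-- The label is regular only on the support, which is closed and of full measure; that suffices for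
almost everywhere measurability. -/
lemma aestronglyMeasurable_of_continuousOn_support {E : Type*} [TopologicalSpace E]
    [TopologicalSpace.PseudoMetrizableSpace E] [SecondCountableTopology E] {g : Seq D N → E}
    (hg : ContinuousOn g μ.support) : AEStronglyMeasurable g μ := by
  have := hg.aestronglyMeasurable (μ := μ) Measure.isClosed_support.measurableSet
  have hsupp : ∀ᵐ H ∂μ, H ∈ μ.support := Measure.support_mem_ae
  rwa [Measure.restrict_eq_self_of_ae_mem hsupp] at this

lemma half_sq_sub_le {x x' y R B : ℝ} (hx : |x| ≤ R) (hx' : |x'| ≤ R) (hy : |y| ≤ B) :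
    1 / 2 * (x' - y) ^ 2 ≤ 1 / 2 * (x - y) ^ 2 + (R + B) * |x' - x| := by
  have e : 1 / 2 * (x' - y) ^ 2 = 1 / 2 * (x - y) ^ 2 + 1 / 2 * ((x' + x - 2 * y) * (x' - x)) := by
    ring
  have h1 : |x' + x - 2 * y| ≤ 2 * (R + B) := by
    rw [abs_le] at *
    constructor <;> linarith
  have h2 := le_abs_self ((x' + x - 2 * y) * (x' - x))
  rw [abs_mul] at h2
  have h3 := mul_le_mul_of_nonneg_right h1 (abs_nonneg (x' - x))
  linarith

lemma continuousOn_extendFlow_support (hD : DataRegularity B Ky μ y)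
    (hf : ParticleGrowth K φP φT f) (hh : ParticleGrowth K φP φT h)
    (hφT : IsGrowthFunction φT) (hK : 0 < K) (hr : 0 < r) (hρ : ρ ∈ P2 p q r) {t : ℝ}
    (ht : t ∈ Icc (0 : ℝ) 1) : ContinuousOn (fun H => extendFlow f h ρ H t) μ.support :=
  (continuousOn_extendFlow hf hh hφT hK hr hρ ht).mono hD.colNorm_le

/-- The risk of the discrete Transformer exceeds the risk of the flow at most by a multiple of an
integrable bound for the distance of the final states. -/
lemma discreteRisk_le_risk_add [IsProbabilityMeasure μ] (hD : DataRegularity B Ky μ y)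
    (hKy : 0 < Ky) (hf : ParticleGrowth K φP φT f) (hh : ParticleGrowth K φP φT h)
    (hφT : IsGrowthFunction φT) (hB : 0 < B) (hK : 0 < K) (hr : 0 < r) (hρ : ρ ∈ P2 p q r)
    (a : Fin D) {L M : ℕ} (hL : 0 < L) (hM : 0 < M) {Θ : Params p q L M}
    (hΘ : ∀ k j, Θ k j ∈ Metric.closedBall 0 r) {δ : Seq D N → ℝ} (hδ : Integrable δ μ)
    (hle : ∀ H ∈ μ.support,
      ‖discreteState f h Θ H (Fin.last L) - extendFlow f h ρ H 1‖ ≤ δ H) :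
    discreteRisk f h μ y a Θ
      ≤ risk f h μ y a ρ + (B * Real.exp (growthRate K r) + B) * ∫ H, δ H ∂μ := by
  set R := B * Real.exp (growthRate K r)
  have hR : 0 < R := by positivity
  have h1 : (1 : ℝ) ∈ Icc (0 : ℝ) 1 := right_mem_Icc.2 zero_le_one
  have hsupp : ∀ᵐ H ∂μ, H ∈ μ.support := Measure.support_mem_ae
  have hx : ∀ H ∈ μ.support, |read a (extendFlow f h ρ H 1)| ≤ R := fun H hH =>
    (abs_read_le_colNorm a _).trans
      (colNorm_extendFlow_le hf hh hφT hK hr hρ (hD.colNorm_le H hH) h1)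
  have hx' : ∀ H ∈ μ.support, |read a (discreteState f h Θ H (Fin.last L))| ≤ R := fun H hH =>
    (abs_read_le_colNorm a _).trans
      (colNorm_discreteState_le_of_le hf hh hK hr hM hL hΘ (hD.colNorm_le H hH) _)
  have hi : Integrable (fun H => 1 / 2 * (read a (extendFlow f h ρ H 1) - y H) ^ 2) μ := by
    refine Integrable.of_bound (C := 1 / 2 * (R + B) ^ 2)
      (aestronglyMeasurable_of_continuousOn_support ?_) ?_
    · exact continuousOn_const.mul ((((continuous_read a).comp_continuousOn
        (continuousOn_extendFlow_support hD hf hh hφT hK hr hρ h1)).sub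
        (hD.continuousOn_label hKy)).pow 2)
    · filter_upwards [hsupp] with H hH
      rw [Real.norm_of_nonneg (by positivity), ← sq_abs]
      have := (abs_sub _ _).trans (add_le_add (hx H hH) (hD.abs_label_le H hH))
      gcongr
  have key : discreteRisk f h μ y a Θ ≤ ∫ H, (1 / 2 * (read a (extendFlow f h ρ H 1) - y H) ^ 2
      + (R + B) * δ H) ∂μ := by
    -- A nonnegative integrand with an integrable majorant suffices, so integrability of the
    -- discrete loss need not be shown.
    refine integral_mono_of_nonneg (Filter.Eventually.of_forall fun H => by positivity)
      (hi.add (hδ.const_mul _)) ?_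
    filter_upwards [hsupp] with H hH
    refine (half_sq_sub_le (hx H hH) (hx' H hH) (hD.abs_label_le H hH)).trans ?_
    have := (abs_read_sub_le a _ _).trans (hle H hH)
    gcongr
  refine key.trans_eq ?_
  rw [integral_add hi (hδ.const_mul _), integral_const_mul _ δ]
  simp only [extendFlow_eq h1, risk]

/-- The grid intervals tile [0, 1] and all averages carry the same factor L, so the penalty has no
discretization error. -/
lemma integral_sq_norm_eq (hr : 0 < r) (hρ : ρ ∈ P2 p q r) {L : ℕ} (hL : 0 < L)
    {τ : ℕ → ℝ} (hτ0 : τ 0 = 0) (hτL : τ L = 1)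
    (hτs : ∀ k < L, τ k ≤ τ (k + 1) ∧ ∫ t in τ k..τ (k + 1), sliceMass ρ t = (L : ℝ)⁻¹) :
    ∑ k : Fin L, ∫ β, ‖β‖ ^ 2 ∂(sliceAverage ρ L (τ k) (τ (k + 1)))
      = L * ∫ t, ∫ β, (‖β.fst‖ ^ 2 + ‖β.snd‖ ^ 2) ∂(ρ t) := by
  have hL' : (0 : ℝ) < L := Nat.cast_pos.2 hL
  have hc : Continuous fun t => ∫ β, ‖β‖ ^ 2 ∂(extendSlices ρ t) := by
    refine continuous_integral_slices hr hρ (C := (2 * r).toNNReal) (by fun_prop)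
      (LipschitzOnWith.of_dist_le_mul fun β hβ β' hβ' => ?_)
    rw [mem_closedBall_zero_iff] at hβ hβ'
    rw [Real.coe_toNNReal _ (by positivity), Real.dist_eq, dist_eq_norm, sq_sub_sq, abs_mul,
      abs_of_nonneg (by positivity)]
    exact mul_le_mul (by linarith) (abs_norm_sub_norm_le _ _) (abs_nonneg _) (by positivity)
  have e : ∫ t, ∫ β, (‖β.fst‖ ^ 2 + ‖β.snd‖ ^ 2) ∂(ρ t)
      = ∫ t in (0 : ℝ)..1, ∫ β, ‖β‖ ^ 2 ∂(extendSlices ρ t) := by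
    rw [← integral_unitInterval_eq]
    simp only [WithLp.prod_norm_sq_eq_of_L2, extendSlices_coe]
  rw [e, ← hτ0, ← hτL, ← intervalIntegral.sum_integral_adjacent_intervals
    fun k _ => hc.intervalIntegrable _ _, ← Fin.sum_univ_eq_sum_range
      (fun k => ∫ t in τ k..τ (k + 1), ∫ β, ‖β‖ ^ 2 ∂(extendSlices ρ t)), Finset.mul_sum]
  refine Finset.sum_congr rfl fun k _ => ?_
  exact integral_sliceAverage hr hρ hL' (hτs k k.2).1 (hτs k k.2).2 (by fun_prop)

/-- For every distribution there is a discrete Transformer that approximates its regularized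
objective. -/
lemma exists_discreteObjective_le [IsProbabilityMeasure μ] (hD : DataRegularity B Ky μ y)
    (hKy : 0 < Ky) (hf : ParticleGrowth K φP φT f) (hh : ParticleGrowth K φP φT h)
    (hφT : IsGrowthFunction φT) (hB : 0 < B) (hK : 0 < K) (hr : 0 < r) (hρ : ρ ∈ P2 p q r)
    (a : Fin D) {L M : ℕ} (hL : 0 < L) (hM : 0 < M) (lam : ℝ) {R ℓ V A : ℝ}
    (hR : R = B * Real.exp (growthRate K r)) (hℓ : ℓ = lipConst φT r ((N + 1) * R))
    (hV : V = (N + 1) * (growthRate K r * R)) (hA : A = (R + B) * Real.exp ℓ) :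
    ∃ Θ : Params p q L M, discreteObjective f h μ y a lam Θ
      ≤ objective f h μ y a lam ρ + A * ((2 * V + 1) / √M + 2 * (ℓ * V) * (L : ℝ)⁻¹) := by
  have hL' : (0 : ℝ) < L := Nat.cast_pos.2 hL
  have hM' : (0 : ℝ) < M := Nat.cast_pos.2 hM
  have hR0 : 0 < R := by rw [hR]; positivity
  have hA0 : 0 < A := by rw [hA]; positivity
  obtain ⟨τ, hτ0, hτL, hτ, hτs⟩ := exists_mass_grid (continuous_sliceMass hr hρ)
    (sliceMass_nonneg ρ) (integral_sliceMass hr hρ) hL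
  set ν : Fin L → Measure (Particle p q) := fun k => sliceAverage ρ L (τ k) (τ (k + 1))
  have hν : ∀ k, IsProbabilityMeasure (ν k) := fun k =>
    isProbabilityMeasure_sliceAverage hr hρ hL' (hτs k k.2).1 (hτs k k.2).2
  have hνS : ∀ k, ν k (Metric.closedBall 0 r)ᶜ = 0 := fun k => sliceAverage_compl_closedBall hr hρ
  -- Setting the flow to zero off the support makes it measurable and bounded everywhere, as the
  -- selection requires.
  set Z : Fin L → Seq D N → Seq D N := fun k =>
    μ.support.indicator fun H => extendFlow f h ρ H (τ k)
  have hZm : ∀ k, StronglyMeasurable (Z k) := fun k => by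
    classical
    have := (continuousOn_extendFlow_support hD hf hh hφT hK hr hρ
      (hτ k k.2.le)).measurable_piecewise (g := 0) continuousOn_const
      Measure.isClosed_support.measurableSet
    rw [piecewise_eq_indicator] at this
    exact this.stronglyMeasurable
  have hZR : ∀ k H, colNorm (Z k H) ≤ R := fun k H => by
    by_cases hH : H ∈ μ.support
    · simp only [Z, indicator_of_mem hH]
      exact hR ▸ colNorm_extendFlow_le hf hh hφT hK hr hρ (hD.colNorm_le H hH) (hτ k k.2.le)
    · simp only [Z, indicator_of_notMem hH, colNorm_zero, hR0.le]
  -- A sampling error of one layer enters the risk bound with weight A / L. The factor lam / (2 A)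
  -- turns this into the weight lam / (2 L) of the mean penalty of a layer.
  choose Θ hΘ hsel using fun k => exists_drift_sample (μ := μ) hf hh hK hr (hνS k) (hZm k) (hZR k)
    hM (lam / (2 * A))
  rw [← hV] at hsel
  refine ⟨Θ, ?_⟩
  have hξi : ∀ k, Integrable (fun H => ‖samplingError f h (ν k) (Θ k) (Z k H)‖) μ := fun k =>
    Integrable.of_bound (C := 2 * V)
      ((stronglyMeasurable_samplingError hf hh (ν k) (Θ k)).comp_measurable
        (hZm k).measurable).norm.aestronglyMeasurable
      (Filter.Eventually.of_forall fun H => by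
        rw [norm_norm, hV]
        exact norm_samplingError_le hf hh hK hr (hνS k) (hZR k H) hM (hΘ k))
  have hrisk := discreteRisk_le_risk_add hD hKy hf hh hφT hB hK hr hρ a hL hM hΘ
    (δ := fun H => Real.exp ℓ * ((L : ℝ)⁻¹ * ∑ k, ‖samplingError f h (ν k) (Θ k) (Z k H)‖
        + 2 * (ℓ * V) * (L : ℝ)⁻¹))
    (((integrable_finsetSum _ fun k _ => hξi k).const_mul _ |>.add (integrable_const _)).const_mul _)
    (fun H hH => by
      simp only [Z, indicator_of_mem hH]
      exact norm_discreteState_sub_extendFlow_le hf hh hφT hK hr hρ hL hM hτ0 hτL hτ hτs hΘ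
        (hD.colNorm_le H hH) hR hℓ hV)
  rw [integral_const_mul, integral_add ((integrable_finsetSum _ fun k _ => hξi k).const_mul _)
    (integrable_const _), integral_const_mul, integral_finsetSum _ fun k _ => hξi k,
    integral_const, probReal_univ, one_smul, ← hR, ← mul_assoc, ← hA] at hrisk
  have hsum := Finset.sum_le_sum fun k (_ : k ∈ Finset.univ) => hsel k
  rw [Finset.sum_add_distrib, Finset.sum_add_distrib, ← Finset.mul_sum, ← Finset.mul_sum,
    ← Finset.mul_sum, integral_sq_norm_eq hr hρ hL hτ0 hτL hτs, Finset.sum_const,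
    Finset.card_univ, Fintype.card_fin, nsmul_eq_mul] at hsum
  have hpen : discreteObjective f h μ y a lam Θ = discreteRisk f h μ y a Θ
      + A * (L : ℝ)⁻¹ * (lam / (2 * A) * ((M : ℝ)⁻¹ * ∑ k, ∑ j, ‖Θ k j‖ ^ 2)) := by
    rw [discreteObjective]
    simp only [WithLp.prod_norm_sq_eq_of_L2]
    field_simp
  have hs := mul_le_mul_of_nonneg_left hsum (mul_nonneg hA0.le (inv_pos.2 hL').le)
  rw [hpen, objective]
  set J := ∫ t, ∫ β, (‖β.fst‖ ^ 2 + ‖β.snd‖ ^ 2) ∂(ρ t)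
  have e : A * (L : ℝ)⁻¹ * (L * ((2 * V + 1) / √M) + lam / (2 * A) * (L * J))
      = A * ((2 * V + 1) / √M) + lam / 2 * J := by
    field_simp
  rw [e] at hs
  linarith

end Risk

/-! ### Preparations for the infima, and the final rate. -/

lemma P2_nonempty (p q : ℕ) {r : ℝ} (hr : 0 < r) : (P2 p q r).Nonempty := by
  refine ⟨Kernel.const _ (Measure.dirac 0), ⟨fun t => ?_, ?_, ?_, 1, one_pos, fun t t' => ?_⟩,
    fun t => ?_⟩
  · rw [Kernel.const_apply]; infer_instance
  · simp
  · simp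
  · simp only [Kernel.const_apply, one_mul]
    refine le_trans (Real.sSup_nonpos ?_) (abs_nonneg _)
    rintro _ ⟨φ, -, -, rfl⟩
    simp
  · have e : {β : Particle p q | ‖β.fst‖ ^ 2 + ‖β.snd‖ ^ 2 ≤ r ^ 2} = Metric.closedBall 0 r :=
      Set.ext fun β => (mem_closedBall_iff_sq hr β).symm
    rw [e, Kernel.const_apply,
      Measure.dirac_apply' _ Metric.isClosed_closedBall.measurableSet.compl]
    simp [hr.le]

lemma discreteRisk_nonneg {L M : ℕ} (f : Seq D N → Vec p → Seq D N)
    (h : Seq D N → Vec q → Seq D N) (μ : Measure (Seq D N)) (y : Seq D N → ℝ) (a : Fin D)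
    (Θ : Params p q L M) : 0 ≤ discreteRisk f h μ y a Θ :=
  integral_nonneg fun H => by positivity

lemma discreteObjective_nonneg {L M : ℕ} (f : Seq D N → Vec p → Seq D N)
    (h : Seq D N → Vec q → Seq D N) (μ : Measure (Seq D N)) (y : Seq D N → ℝ) (a : Fin D)
    {lam : ℝ} (hlam : 0 ≤ lam) (Θ : Params p q L M) :
    0 ≤ discreteObjective f h μ y a lam Θ :=
  add_nonneg (discreteRisk_nonneg f h μ y a Θ) (by positivity)

/-- The selection gives the rate M^(-1/2) without a logarithm; since log (L + 1) ≥ log 2, this fits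
the form of the claim. -/
lemma inv_sqrt_le_sqrt_log {L M : ℕ} (hL : 0 < L) :
    1 / √(M : ℝ) ≤ (√(Real.log 2))⁻¹ * √(Real.log (L + 1) / M) := by
  have h2 : 0 < Real.log 2 := Real.log_pos one_lt_two
  have hL' : (1 : ℝ) ≤ L := by exact_mod_cast hL
  have h3 : √(Real.log 2) ≤ √(Real.log (L + 1)) :=
    Real.sqrt_le_sqrt (Real.log_le_log two_pos (by linarith))
  have h4 : 0 < √(Real.log 2) := Real.sqrt_pos.2 h2
  rw [Real.sqrt_div (h2.le.trans (Real.log_le_log two_pos (by linarith))), ← mul_div_assoc]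
  gcongr
  rw [inv_mul_eq_div, one_le_div h4]
  exact h3

end MeanFieldTransformer
end

theorem mainTheorem5 (N D : ℕ) (r B Ky K : ℝ) (hr : 0 < r) (hB : 0 < B) (hKy : 0 < Ky)
    (hK : 0 < K) (φP φT : ℝ → ℝ) (hφP : MeanFieldTransformer.IsGrowthFunction φP)
    (hφT : MeanFieldTransformer.IsGrowthFunction φT) :
    ∃ C : ℝ, 0 < C ∧
      ∀ (p q : ℕ)
        (f : MeanFieldTransformer.Seq D N → MeanFieldTransformer.Vec p →
          MeanFieldTransformer.Seq D N)
        (h : MeanFieldTransformer.Seq D N → MeanFieldTransformer.Vec q →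
          MeanFieldTransformer.Seq D N)
        (μ : Measure (MeanFieldTransformer.Seq D N)) (y : MeanFieldTransformer.Seq D N → ℝ)
        (a : Fin D),
        IsProbabilityMeasure μ →
        MeanFieldTransformer.DataRegularity B Ky μ y →
        MeanFieldTransformer.ParticleGrowth K φP φT f →
        MeanFieldTransformer.ParticleGrowth K φP φT h →
        ∀ L M : ℕ, 0 < L → 0 < M →
          (⨅ Θ : MeanFieldTransformer.Params p q L M,
              MeanFieldTransformer.discreteRisk f h μ y a Θ) ≤
            (⨅ ρ : MeanFieldTransformer.P2 p q r, MeanFieldTransformer.risk f h μ y a ρ)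
              + C * ((L : ℝ)⁻¹ + Real.sqrt (Real.log (L + 1) / M)) ∧
          ∀ lam : ℝ, 0 < lam →
            (⨅ Θ : MeanFieldTransformer.Params p q L M,
                MeanFieldTransformer.discreteObjective f h μ y a lam Θ) ≤
              (⨅ ρ : MeanFieldTransformer.P2 p q r,
                  MeanFieldTransformer.objective f h μ y a lam ρ)
                + C * (1 + lam) * ((L : ℝ)⁻¹ + Real.sqrt (Real.log (L + 1) / M)) := by
  open MeanFieldTransformer in
  obtain ⟨R, hR⟩ : ∃ R, R = B * Real.exp (growthRate K r) := ⟨_, rfl⟩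
  obtain ⟨ℓ, hℓ⟩ : ∃ ℓ, ℓ = lipConst φT r ((N + 1) * R) := ⟨_, rfl⟩
  obtain ⟨V, hV⟩ : ∃ V, V = (N + 1) * (growthRate K r * R) := ⟨_, rfl⟩
  obtain ⟨A, hA⟩ : ∃ A, A = (R + B) * Real.exp ℓ := ⟨_, rfl⟩
  have hR0 : 0 < R := by rw [hR]; positivity
  have hℓ0 : 0 ≤ ℓ := hℓ ▸ lipConst_nonneg φT hr _
  have hV0 : 0 ≤ V := by
    have := growthRate_nonneg hK hr
    rw [hV]; positivity
  have hA0 : 0 < A := by rw [hA]; positivity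
  have hlog : 0 < √(Real.log 2) := Real.sqrt_pos.2 (Real.log_pos one_lt_two)
  set C₁ := A * ((2 * V + 1) * (√(Real.log 2))⁻¹)
  set C₂ := A * (2 * (ℓ * V))
  have hC₁ : 0 < C₁ := by positivity
  have hC₂ : 0 ≤ C₂ := by positivity
  refine ⟨C₁ + C₂, by positivity, fun p q f h μ y a _ hD hf hh L M hL hM => ?_⟩
  -- A lower bound for all members passes to a real infimum only over a nonempty index type.
  have : Nonempty (P2 p q r) := (P2_nonempty p q hr).to_subtype
  set s := Real.sqrt (Real.log (L + 1) / M) with hs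
  have hs0 : 0 ≤ s := Real.sqrt_nonneg _
  have hL0 : (0 : ℝ) ≤ (L : ℝ)⁻¹ := by positivity
  have key : ∀ (ρ : P2 p q r) (lam : ℝ), ∃ Θ : Params p q L M,
      discreteObjective f h μ y a lam Θ
        ≤ objective f h μ y a lam ρ + (C₁ + C₂) * ((L : ℝ)⁻¹ + s) := fun ρ lam => by
    obtain ⟨Θ, hΘ⟩ := exists_discreteObjective_le hD hKy hf hh hφT hB hK hr ρ.2 a hL hM lam
      hR hℓ hV hA
    refine ⟨Θ, hΘ.trans (add_le_add_right ?_ _)⟩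
    have h1 : A * ((2 * V + 1) / √M) ≤ C₁ * s := by
      have := inv_sqrt_le_sqrt_log (M := M) hL
      calc A * ((2 * V + 1) / √M) = A * (2 * V + 1) * (1 / √M) := by ring
        _ ≤ A * (2 * V + 1) * ((√(Real.log 2))⁻¹ * s) := by gcongr
        _ = C₁ * s := by ring
    have h2 : A * (2 * (ℓ * V) * (L : ℝ)⁻¹) = C₂ * (L : ℝ)⁻¹ := by ring
    nlinarith [mul_nonneg hC₁.le hL0, mul_nonneg hC₂ hs0]
  constructor
  · rw [← sub_le_iff_le_add]
    refine le_ciInf fun ρ => ?_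
    -- At λ = 0 the objectives reduce to the risks.
    obtain ⟨Θ, hΘ⟩ := key ρ 0
    simp only [discreteObjective, objective, zero_div, zero_mul, add_zero] at hΘ
    have := ciInf_le (f := fun Θ : Params p q L M => discreteRisk f h μ y a Θ)
      ⟨0, by rintro _ ⟨Θ, rfl⟩; exact discreteRisk_nonneg f h μ y a Θ⟩ Θ
    linarith
  · intro lam hlam
    rw [← sub_le_iff_le_add]
    refine le_ciInf fun ρ => ?_
    obtain ⟨Θ, hΘ⟩ := key ρ lam
    have := ciInf_le (f := fun Θ : Params p q L M => discreteObjective f h μ y a lam Θ)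
      ⟨0, by rintro _ ⟨Θ, rfl⟩; exact discreteObjective_nonneg f h μ y a hlam.le Θ⟩ Θ
    -- The bound from `key` has no factor 1 + λ; this nonnegative surplus is the difference from the
    -- claimed bound.
    have h3 : 0 ≤ lam * ((C₁ + C₂) * ((L : ℝ)⁻¹ + s)) := by positivity
    linarith
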